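/- **Theorem (Exchangeable Cluster/Partition Probability Functions).** Let $\Omega$ be a measurable space possessing a countable family of measurable sets that separates points (e.g. a Polish space with its Borel sets), let $G_0$ be a finite measure on $\Omega$ with $G_0(\{\omega\})=0$ for all $\omega\in\Omega$, put $\gamma_0=G_0(\Omega)$, and let $\rho$ be a measure with $\int_{(0,\infty)}\min\{1,r\}\,\rho(dr)<\infty$; all integrals $\int_0^\infty$ below are over $(0,\infty)$. Let $$G=\sum_{k<K} r_k\,\delta_{\omega_k},\qquad K\in\{0,1,2,\dots,\infty\},$$ with random weights $r_k>0$ and pairwise distinct random atoms $\omega_k\in\Omega$, be a completely random measure with $G(\Omega)<\infty$ a.s. and Lévy measure $\nu(dr\,d\omega)=\rho(dr)G_0(d\omega)$; that is, $G$ takes independent values on disjoint measurable sets and $\mathbb E[e^{iuG(A)}]=\exp\big(\iint_{(0,\infty)\times A}(e^{iur}-1)\,\nu(dr\,d\omega)\big)$ for measurable $A\subset\Omega$, $u\in\mathbb R$. In the *count-mixture model*, conditionally on $(K,(r_k),(\omega_k))$, the sample size is $m\sim\mathrm{Pois}(G(\Omega))$ and, given $m$, the labels $z_1,\dots,z_m$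 are i.i.d. with distribution $\sum_{k<K}\frac{r_k}{G(\Omega)}\delta_k$ (if $G(\Omega)=0$ then $m=0$). Relabel $\boldsymbol z=(z_1,\dots,z_m)$ in order of appearance by $1,\dots,l$, where $l$ is the number of distinct labels (clusters), and let $n_k$ be the number of $i\le m$ with relabelled $z_i=k$. Then: 1. *(ECPF)* For every $m\ge 0$ and every sequence $\boldsymbol z\in\{1,2,\dots\}^m$ labelled in order of appearance, the probability $f(\boldsymbol z,m\mid\gamma_0,\rho)$ that the sample has size $m$ and relabelled labels $\boldsymbol z$ is $$f(\boldsymbol z,m\mid\gamma_0,\rho)=\mathbb E_G[f(\boldsymbol z,m\mid G)]=\frac{\gamma_0^{\,l}}{m!}\,\exp\Big(\gamma_0\int_0^\infty(e^{-r}-1)\,\rho(dr)\Big)\prod_{k=1}^{l}\int_0^\infty r^{n_k}e^{-r}\,\rho(dr),$$ where $f(\boldsymbol z,m\mid G)$ is the conditional probability of the same event given $(K,(r_k),(\omega_k))$. In particular it is exchangeable: it depends on $\boldsymbol z$ only through the number and the (unordered) sizes of the clusters. All the integrals (here and in 2) converge. 2. *(Sample size)* For real $t$ with $|t|\le 1$,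 the PGF of $m$ is $$\mathbb E[t^m]=\exp\Big(\gamma_0\int_0^\infty\big(e^{-(1-t)r}-1\big)\,\rho(dr)\Big).$$ It is analytic at $t=0$, and the PMF of $m$ is $f_M(m\mid\gamma_0,\rho)=\frac1{m!}\,\frac{d^m}{dt^m}\,\mathbb E[t^{m}]\Big|_{t=0}$ (here the expectation is the PGF as a function of $t$, differentiated $m$ times). 3. *(EPPF)* Whenever $f_M(m\mid\gamma_0,\rho)>0$, the conditional probability of the relabelled sequence $\boldsymbol z$ given that the sample has size $m$ is $$f(\boldsymbol z\mid m,\gamma_0,\rho)=\frac{f(\boldsymbol z,m\mid\gamma_0,\rho)}{f_M(m\mid\gamma_0,\rho)},$$ with $f(\boldsymbol z,m\mid\gamma_0,\rho)$ given by the product formula in 1, and it is exchangeable in the same sense. -/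

import Mathlib

open MeasureTheory ProbabilityTheory Set

noncomputable section

namespace CountMixture

/-- The discrete measure `∑_{k < K} r_k δ_{ω_k}`, where `K ≤ ∞`. -/
def atomicMeasure {Ω : Type*} [MeasurableSpace Ω] (K : ℕ∞) (r : ℕ → ℝ) (ω : ℕ → Ω) :
    Measure Ω :=
  Measure.sum fun k : {k : ℕ // (k : ℕ∞) < K} => ENNReal.ofReal (r k) • Measure.dirac (ω k)

/-- The homogeneous Lévy measure `ν(dr dω) = ρ(dr) G₀(dω)` on `(0, ∞) × Ω`. -/
def levyMeasure {Ω : Type*} [MeasurableSpace Ω] (ρ : Measure ℝ) (G₀ : Measure Ω) :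
    Measure (ℝ × Ω) :=
  (ρ.restrict (Ioi 0)).prod G₀

/-- `G` is a completely random measure with (almost surely) finite total mass and Lévy
measure `ν`: the masses of disjoint measurable sets are independent, and
`E[exp(iuG(A))] = exp(∫∫_{ℝ₊ × A} (e^{iur} - 1) ν(dr dω))`. -/
structure IsCompletelyRandomMeasure {S Ω : Type*} [MeasurableSpace S] [MeasurableSpace Ω]
    (P : Measure S) (G : S → Measure Ω) (ν : Measure (ℝ × Ω)) : Prop where
  measurable : Measurable G
  finite : ∀ᵐ s ∂P, G s univ < ⊤
  indep : ∀ (n : ℕ) (A : Fin n → Set Ω), (∀ i, MeasurableSet (A i)) →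
    (∀ i j, i ≠ j → Disjoint (A i) (A j)) → iIndepFun (fun i s => G s (A i)) P
  charFun : ∀ A : Set Ω, MeasurableSet A → ∀ u : ℝ,
    ∫ s, Complex.exp (Complex.I * u * ((G s A).toReal : ℂ)) ∂P =
      Complex.exp (∫ x in univ ×ˢ A, (Complex.exp (Complex.I * u * (x.1 : ℂ)) - 1) ∂ν)

/-- The conditional likelihood of `(z, m)` given `G = ∑_{k < K} r_k δ_{ω_k}`:
`m ∼ Pois(G(Ω))` and, given `m`, the labels `z_1, …, z_m` are independent draws from
`∑_{k < K} (r_k / G(Ω)) δ_k`. -/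
def likelihood {Ω : Type*} [MeasurableSpace Ω] (K : ℕ∞) (r : ℕ → ℝ) (ω : ℕ → Ω)
    (m : ℕ) (c : Fin m → ℕ) : ℝ :=
  (poissonMeasure (atomicMeasure K r ω univ).toNNReal).real {m} *
    ∏ i, if (c i : ℕ∞) < K then r (c i) / (atomicMeasure K r ω univ).toReal else 0

/-- The σ-algebra generated by the atoms `(K, r, ω)` of `G`. -/
abbrev atomsSigma {S Ω : Type*} [MeasurableSpace Ω]
    (K : S → ℕ∞) (r : ℕ → S → ℝ) (ω : ℕ → S → Ω) : MeasurableSpace S :=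
  MeasurableSpace.comap (fun s => (K s, (fun k => r k s), (fun k => ω k s))) inferInstance

/-- The count-mixture model. The random measure `G = ∑_{k < K} r_k δ_{ω_k}`, with weights
`r_k > 0` at pairwise distinct atoms `ω_k`, is a completely random measure with Lévy measure
`ρ(dr) G₀(dω)`; given the atoms of `G`, the sample size `M` is Poisson with mean `G(Ω)`, and the
labels `z_0, …, z_{M-1}` are iid with `P(z_i = k) = r_k / G(Ω)` (the later `z_i` play no role). -/
structure IsCountMixture {S Ω : Type*} [MeasurableSpace S] [MeasurableSpace Ω]
    (P : Measure S) (G₀ : Measure Ω) (ρ : Measure ℝ)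
    (K : S → ℕ∞) (r : ℕ → S → ℝ) (ω : ℕ → S → Ω) (M : S → ℕ) (z : ℕ → S → ℕ) : Prop where
  measurable_K : Measurable K
  measurable_r : ∀ k, Measurable (r k)
  measurable_ω : ∀ k, Measurable (ω k)
  measurable_M : Measurable M
  measurable_z : ∀ i, Measurable (z i)
  pos : ∀ᵐ s ∂P, ∀ k : ℕ, (k : ℕ∞) < K s → 0 < r k s
  distinct : ∀ᵐ s ∂P, ∀ j k : ℕ, (j : ℕ∞) < K s → (k : ℕ∞) < K s → ω j s = ω k s → j = k
  crm : IsCompletelyRandomMeasure P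
    (fun s => atomicMeasure (K s) (fun k => r k s) (fun k => ω k s)) (levyMeasure ρ G₀)
  sample : ∀ (m : ℕ) (c : Fin m → ℕ),
    P⟦{s | M s = m ∧ (fun i : Fin m => z i s) = c} | atomsSigma K r ω⟧ =ᵐ[P]
      fun s => likelihood (K s) (fun k => r k s) (fun k => ω k s) m c

/-- Relabelling of a finite sequence in order of appearance, by `1, 2, …, l`: the new label of
`z_i` is the number of distinct values among `z_0, …, z_j`, where `j` is the first index with
`z_j = z_i`. -/
def relabel {m : ℕ} (z : Fin m → ℕ) (i : Fin m) : ℕ :=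
  ((Finset.univ.filter fun j : Fin m => ∀ k, z k = z i → j ≤ k).image z).card

/-- The number `l` of clusters. -/
def numClusters {m : ℕ} (c : Fin m → ℕ) : ℕ := (Finset.univ.image c).card

/-- The size `n_k` of cluster `k`. -/
def clusterSize {m : ℕ} (c : Fin m → ℕ) (k : ℕ) : ℕ :=
  (Finset.univ.filter fun i => c i = k).card

/-- The unordered cluster sizes `n_1, …, n_l` (with multiplicity). -/
def clusterSizes {m : ℕ} (c : Fin m → ℕ) : Multiset ℕ :=
  (Finset.Icc 1 (numClusters c)).val.map (clusterSize c)

/-- The event that the sample has size `m` and its labels, in order of appearance, are `c`. -/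
def clusterEvent {S : Type*} (M : S → ℕ) (z : ℕ → S → ℕ) (m : ℕ) (c : Fin m → ℕ) : Set S :=
  {s | M s = m ∧ relabel (fun i : Fin m => z i s) = c}

/-- The cluster probability function `f(z, m)`: joint distribution of the sample size and of the
labels in order of appearance. -/
def ecpf {S : Type*} [MeasurableSpace S] (P : Measure S) (M : S → ℕ) (z : ℕ → S → ℕ)
    (m : ℕ) (c : Fin m → ℕ) : ℝ :=
  P.real (clusterEvent M z m c)

/-- The probability mass function `f_M(m)` of the sample size. -/
def sizePMF {S : Type*} [MeasurableSpace S] (P : Measure S) (M : S → ℕ) (m : ℕ) : ℝ :=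
  P.real {s | M s = m}

/-- The probability generating function `t ↦ E[t^M]` of the sample size. -/
def sizePGF {S : Type*} [MeasurableSpace S] (P : Measure S) (M : S → ℕ) (t : ℝ) : ℝ :=
  ∫ s, t ^ M s ∂P

/-- The partition probability function `f(z | m)`: conditional distribution, given that the
sample has size `m`, of the labels in order of appearance. -/
def eppf {S : Type*} [MeasurableSpace S] (P : Measure S) (M : S → ℕ) (z : ℕ → S → ℕ)
    (m : ℕ) (c : Fin m → ℕ) : ℝ :=
  (P[|{s | M s = m}]).real {s | relabel (fun i : Fin m => z i s) = c}

/-- A function of label sequences in order of appearance is exchangeable if it depends only on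
the number and the sizes of the clusters, regardless of their order. -/
def IsExchangeable (f : ∀ m : ℕ, (Fin m → ℕ) → ℝ) : Prop :=
  ∀ (m : ℕ) (c c' : Fin m → ℕ), relabel c = c → relabel c' = c' →
    clusterSizes c = clusterSizes c' → f m c = f m c'

/-- The product formula
`γ₀^l / m! · exp(γ₀ ∫ (e^{-r} - 1) ρ(dr)) · ∏_{k=1}^l ∫ r^{n_k} e^{-r} ρ(dr)`. -/
def ecpfFormula (γ₀ : ℝ) (ρ : Measure ℝ) (m : ℕ) (c : Fin m → ℕ) : ℝ :=
  γ₀ ^ numClusters c / (m.factorial : ℝ) *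
    Real.exp (γ₀ * ∫ r in Ioi (0 : ℝ), (Real.exp (-r) - 1) ∂ρ) *
    ∏ k ∈ Finset.Icc 1 (numClusters c),
      ∫ r in Ioi (0 : ℝ), r ^ clusterSize c k * Real.exp (-r) ∂ρ

end CountMixture

end

/-!
Given `G`, the sample size is `m` with probability `e^{-G(Ω)} G(Ω)^m / m!`, so the probability that
it is `m` and that the sample is clustered like `c` is `E[e^{-G(Ω)} G^{⊗m}(Δ_c)] / m!`, where `Δ_c`
is the set of the points of `Ω^m` whose coordinates coincide exactly where those of `c` do: the
atoms of `G` being distinct, equal labels are equal atoms.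

Approximate `Δ_c` by finite measurable partitions of `Ω` that separate points in the limit.
For a partition, independence of `G` on its cells turns the expectation into
`e^{G₀(Ω) ψ(-1)}`, with `ψ` the Laplace exponent of `ρ`, times a sum over injective assignments of
cells to clusters of products of tilted moments `E[G(A)^n e^{-G(A)}] / E[e^{-G(A)}]`. Such a moment
is a polynomial in `G₀(A)`, the complete Bell polynomial, whose constant term vanishes and whose
linear coefficient is `κ_n = ∫ r^n e^{-r} ρ(dr)`. As the partition is refined all cell masses tend
to zero because `G₀` is diffuse, so only the linear terms survive and each cluster of size `n`
contributes `G₀(Ω) κ_n`.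
-/

noncomputable section

namespace CountMixture

open Filter Topology

theorem norm_cexp_sub_one_le {w : ℂ} (hw : w.re ≤ 0) : ‖Complex.exp w - 1‖ ≤ ‖w‖ := by
  have h := (convex_halfSpace_re_le 0).norm_image_sub_le_of_norm_deriv_le (f := Complex.exp)
    (C := 1) (x := 0) (y := w) (fun z _ => Complex.differentiable_exp z)
    (fun z hz => by simpa [Complex.norm_exp] using hz) (by simp) hw
  simpa using h

theorem norm_cexp_mul_le_one {w : ℂ} (hw : w.re ≤ 0) {x : ℝ} (hx : 0 ≤ x) :
    ‖Complex.exp (w * x)‖ ≤ 1 := by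
  rw [Complex.norm_exp, Complex.re_mul_ofReal]
  exact Real.exp_le_one_iff.2 (mul_nonpos_of_nonpos_of_nonneg hw hx)

theorem norm_cexp_mul_sub_one_le {w : ℂ} (hw : w.re ≤ 0) {x : ℝ} (hx : 0 ≤ x) :
    ‖Complex.exp (w * x) - 1‖ ≤ (2 + ‖w‖) * min 1 x := by
  rcases le_total 1 x with h | h
  · have hnorm := norm_sub_le (Complex.exp (w * x)) 1
    rw [norm_one] at hnorm
    rw [min_eq_left h]
    linarith [norm_cexp_mul_le_one hw hx, norm_nonneg w]
  · have hre : (w * x).re ≤ 0 := by simpa using mul_nonpos_of_nonpos_of_nonneg hw hx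
    have hnorm := norm_cexp_sub_one_le hre
    rw [norm_mul, Complex.norm_real, Real.norm_of_nonneg hx] at hnorm
    rw [min_eq_right h]
    linarith

theorem mul_exp_neg_mul_le {ε : ℝ} (hε : 0 < ε) {x : ℝ} (hx : 0 ≤ x) :
    x * Real.exp (-ε * x) ≤ (1 + 1 / ε) * min 1 x := by
  have hexp : Real.exp (-ε * x) ≤ 1 := Real.exp_le_one_iff.2 (by nlinarith)
  rcases le_total 1 x with h | h
  · have hmul : x * Real.exp (-ε * x) ≤ 1 / ε := by
      rw [neg_mul, Real.exp_neg, ← div_eq_mul_inv, div_le_div_iff₀ (Real.exp_pos _) hε]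
      linarith [Real.add_one_le_exp (ε * x)]
    rw [min_eq_left h]
    linarith
  · have hinv : 0 < 1 / ε := by positivity
    rw [min_eq_right h]
    nlinarith

theorem pow_mul_exp_neg_le_factorial (n : ℕ) {x : ℝ} (hx : 0 ≤ x) :
    x ^ n * Real.exp (-x) ≤ n.factorial := by
  have h := Real.pow_div_factorial_le_exp x hx n
  rw [Real.exp_neg, ← div_eq_mul_inv, div_le_iff₀ (Real.exp_pos x)]
  rwa [div_le_iff₀ (by positivity), mul_comm] at h

theorem pow_mul_exp_neg_le_factorial_mul_min {n : ℕ} (hn : n ≠ 0) {x : ℝ} (hx : 0 ≤ x) :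
    x ^ n * Real.exp (-x) ≤ n.factorial * min 1 x := by
  rcases le_total 1 x with h | h
  · simpa [min_eq_left h] using pow_mul_exp_neg_le_factorial n hx
  · have hfact : (1 : ℝ) ≤ n.factorial := by exact_mod_cast n.factorial_pos
    rw [min_eq_right h]
    calc x ^ n * Real.exp (-x) ≤ x * 1 := by
          gcongr
          · exact pow_le_of_le_one hx h hn
          · exact Real.exp_le_one_iff.2 (neg_nonpos.2 hx)
      _ ≤ n.factorial * x := by nlinarith

/-- A measure on `[0, ∞)` integrating `min 1 r`, as is the Lévy measure of a subordinator. Unlike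
for Lévy measures an atom at `0` is allowed, so that the law of a nonnegative random variable
qualifies. -/
structure IsSubordinatorMeasure (ν : Measure ℝ) : Prop where
  ae_nonneg : ∀ᵐ r ∂ν, 0 ≤ r
  integrable_min_one : Integrable (fun r => min 1 r) ν

/-- The Laplace exponent of `ν` at a complex argument `w`; it converges absolutely for
`w.re ≤ 0`. -/
def complexLaplaceExponent (ν : Measure ℝ) (w : ℂ) : ℂ :=
  ∫ r, (Complex.exp (w * r) - 1) ∂ν

/-- The Laplace exponent of `ν`, with the sign convention of `mgf`: it converges absolutely for
`t ≤ 0`. -/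
def laplaceExponent (ν : Measure ℝ) (t : ℝ) : ℝ :=
  ∫ r, (Real.exp (t * r) - 1) ∂ν

/-- The `n`-th moment of the exponential tilting of `ν`. -/
def tiltedMoment (ν : Measure ℝ) (n : ℕ) : ℝ :=
  ∫ r, r ^ n * Real.exp (-r) ∂ν

/-- The size-biased measure `r ν(dr)`, whose moment generating function is the derivative of the
Laplace exponent of `ν`. -/
def sizeBiased (ν : Measure ℝ) : Measure ℝ :=
  ν.withDensity ENNReal.ofReal

theorem complexLaplaceExponent_ofReal (ν : Measure ℝ) (t : ℝ) :
    complexLaplaceExponent ν t = laplaceExponent ν t := by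
  rw [complexLaplaceExponent, laplaceExponent, ← integral_complex_ofReal]
  push_cast
  rfl

theorem isSubordinatorMeasure_restrict_Ioi {ρ : Measure ℝ}
    (hρ : ∫⁻ r in Ioi (0 : ℝ), ENNReal.ofReal (min 1 r) ∂ρ < ⊤) :
    IsSubordinatorMeasure (ρ.restrict (Ioi 0)) := by
  have hnonneg : ∀ᵐ r ∂ρ.restrict (Ioi 0), 0 ≤ r :=
    (ae_restrict_mem measurableSet_Ioi).mono fun r hr => le_of_lt hr
  refine ⟨hnonneg, by fun_prop, ?_⟩
  rw [hasFiniteIntegral_iff_ofReal]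
  · exact hρ
  · filter_upwards [hnonneg] with r hr using le_min zero_le_one hr

namespace IsSubordinatorMeasure

variable {ν : Measure ℝ}

theorem of_isFiniteMeasure [IsFiniteMeasure ν] (h : ∀ᵐ r ∂ν, 0 ≤ r) :
    IsSubordinatorMeasure ν := by
  refine ⟨h, (integrable_const (1 : ℝ)).mono' (by fun_prop) ?_⟩
  filter_upwards [h] with r hr
  rw [Real.norm_of_nonneg (le_min zero_le_one hr)]
  exact min_le_left _ _

theorem integrable_cexp_mul_sub_one (hν : IsSubordinatorMeasure ν) {w : ℂ} (hw : w.re ≤ 0) :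
    Integrable (fun r : ℝ => Complex.exp (w * r) - 1) ν := by
  refine (hν.integrable_min_one.const_mul (2 + ‖w‖)).mono' (by fun_prop) ?_
  filter_upwards [hν.ae_nonneg] with r hr using norm_cexp_mul_sub_one_le hw hr

theorem integrable_exp_mul_sub_one (hν : IsSubordinatorMeasure ν) {t : ℝ} (ht : t ≤ 0) :
    Integrable (fun r => Real.exp (t * r) - 1) ν := by
  have h : Integrable (fun r : ℝ => ((Real.exp (t * r) - 1 : ℝ) : ℂ)) ν := by
    push_cast
    exact hν.integrable_cexp_mul_sub_one (by simpa using ht)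
  simpa only [RCLike.re_to_complex, Complex.ofReal_re] using h.re

theorem integrable_pow_mul_exp_neg (hν : IsSubordinatorMeasure ν) {n : ℕ} (hn : n ≠ 0) :
    Integrable (fun r => r ^ n * Real.exp (-r)) ν := by
  refine (hν.integrable_min_one.const_mul (n.factorial : ℝ)).mono' (by fun_prop) ?_
  filter_upwards [hν.ae_nonneg] with r hr
  rw [Real.norm_of_nonneg (by positivity)]
  exact pow_mul_exp_neg_le_factorial_mul_min hn hr

theorem re_complexLaplaceExponent_nonpos (hν : IsSubordinatorMeasure ν) {w : ℂ}
    (hw : w.re ≤ 0) : (complexLaplaceExponent ν w).re ≤ 0 := by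
  have hre : (complexLaplaceExponent ν w).re = ∫ r : ℝ, (Complex.exp (w * r) - 1).re ∂ν :=
    (integral_re (𝕜 := ℂ) (hν.integrable_cexp_mul_sub_one hw)).symm
  rw [hre]
  refine integral_nonpos_of_ae ?_
  filter_upwards [hν.ae_nonneg] with r hr
  simpa using (Complex.re_le_norm _).trans (norm_cexp_mul_le_one hw hr)

theorem hasDerivAt_complexLaplaceExponent (hν : IsSubordinatorMeasure ν) {w : ℂ}
    (hw : w.re < 0) :
    HasDerivAt (complexLaplaceExponent ν) (∫ r : ℝ, r * Complex.exp (w * r) ∂ν) w := by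
  have hε : 0 < -w.re / 2 := by linarith
  have hs : {z : ℂ | z.re < w.re / 2} ∈ 𝓝 w :=
    (isOpen_Iio.preimage Complex.continuous_re).mem_nhds (by simp; linarith)
  refine (hasDerivAt_integral_of_dominated_loc_of_deriv_le (μ := ν)
    (F := fun w r => Complex.exp (w * (r : ℝ)) - 1) (F' := fun w r => r * Complex.exp (w * r))
    (bound := fun r => (1 + 1 / (-w.re / 2)) * min 1 r) hs
    (Eventually.of_forall fun z => by fun_prop) (hν.integrable_cexp_mul_sub_one hw.le)
    (by fun_prop) ?_ (hν.integrable_min_one.const_mul _)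
    (Eventually.of_forall fun r z _ => ?_)).2
  · filter_upwards [hν.ae_nonneg] with r hr z hz
    refine le_trans ?_ (mul_exp_neg_mul_le hε hr)
    rw [norm_mul, Complex.norm_exp, Complex.norm_real, Real.norm_of_nonneg hr,
      Complex.re_mul_ofReal]
    have hz' : z.re ≤ -(-w.re / 2) := by linarith [mem_ofPred.1 hz]
    gcongr
  · simpa [mul_comm] using (((hasDerivAt_id z).mul_const (r : ℂ)).cexp).sub_const 1

theorem continuousOn_complexLaplaceExponent (hν : IsSubordinatorMeasure ν) :
    ContinuousOn (complexLaplaceExponent ν) {w | w.re ≤ 0} := by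
  intro w _
  refine tendsto_integral_filter_of_dominated_convergence
    (fun r => (2 + (‖w‖ + 1)) * min 1 r) (Eventually.of_forall fun z => by fun_prop) ?_
    (hν.integrable_min_one.const_mul _)
    (Eventually.of_forall fun r => (Continuous.tendsto (by fun_prop) w).mono_left
      nhdsWithin_le_nhds)
  have hnorm : ∀ᶠ z in 𝓝[{w : ℂ | w.re ≤ 0}] w, ‖z‖ < ‖w‖ + 1 :=
    (continuous_norm.tendsto w).mono_left nhdsWithin_le_nhds |>.eventually_lt_const (by linarith)
  filter_upwards [hnorm, self_mem_nhdsWithin] with z hz hz'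
  filter_upwards [hν.ae_nonneg] with r hr
  refine (norm_cexp_mul_sub_one_le hz' hr).trans ?_
  have : 0 ≤ min 1 r := le_min zero_le_one hr
  gcongr

theorem diffContOnCl_complexLaplaceExponent (hν : IsSubordinatorMeasure ν) :
    DiffContOnCl ℂ (complexLaplaceExponent ν) {w | w.re < 0} := by
  refine ⟨fun w hw => (hν.hasDerivAt_complexLaplaceExponent
    hw).differentiableAt.differentiableWithinAt, ?_⟩
  rw [Complex.closure_setOfPred_re_lt]
  exact hν.continuousOn_complexLaplaceExponent

theorem integral_sizeBiased (hν : IsSubordinatorMeasure ν) (f : ℝ → ℝ) :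
    ∫ r, f r ∂(sizeBiased ν) = ∫ r, r * f r ∂ν := by
  rw [sizeBiased, integral_withDensity_eq_integral_toReal_smul (by fun_prop) (by simp)]
  refine integral_congr_ae ?_
  filter_upwards [hν.ae_nonneg] with r hr
  rw [ENNReal.toReal_ofReal hr, smul_eq_mul]

theorem Iio_subset_interior_integrableExpSet_sizeBiased (hν : IsSubordinatorMeasure ν) :
    Iio 0 ⊆ interior (integrableExpSet id (sizeBiased ν)) := by
  refine interior_maximal (fun t (ht : t < 0) => ?_) isOpen_Iio
  rw [integrableExpSet, mem_ofPred, sizeBiased,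
    integrable_withDensity_iff_integrable_smul' (by fun_prop) (by simp)]
  refine (hν.integrable_min_one.const_mul (1 + 1 / -t)).mono' (by fun_prop) ?_
  filter_upwards [hν.ae_nonneg] with r hr
  rw [ENNReal.toReal_ofReal hr, smul_eq_mul, Real.norm_of_nonneg (by positivity)]
  simpa using mul_exp_neg_mul_le (neg_pos.2 ht) hr

theorem hasDerivAt_laplaceExponent (hν : IsSubordinatorMeasure ν) {t : ℝ} (ht : t < 0) :
    HasDerivAt (laplaceExponent ν) (mgf id (sizeBiased ν) t) t := by
  have h := (hν.hasDerivAt_complexLaplaceExponent (w := t) (by simpa using ht)).real_of_complex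
  simp only [complexLaplaceExponent_ofReal, Complex.ofReal_re] at h
  have hmgf : ∫ r : ℝ, r * Complex.exp (t * r) ∂ν = (mgf id (sizeBiased ν) t : ℂ) := by
    rw [mgf, hν.integral_sizeBiased, ← integral_complex_ofReal]
    push_cast
    rfl
  rwa [hmgf, Complex.ofReal_re] at h

theorem iteratedDeriv_mgf_sizeBiased (hν : IsSubordinatorMeasure ν) (n : ℕ) :
    iteratedDeriv n (mgf id (sizeBiased ν)) (-1) = tiltedMoment ν (n + 1) := by
  rw [iteratedDeriv_mgf (hν.Iio_subset_interior_integrableExpSet_sizeBiased (by simp)),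
    hν.integral_sizeBiased, tiltedMoment]
  congr with r
  simp only [id_eq, neg_one_mul]
  ring

end IsSubordinatorMeasure

section Uniqueness

theorem eqOn_re_nonpos_of_eqOn_imaginary_axis {E : Type*} [NormedAddCommGroup E]
    [NormedSpace ℂ E] {f g : ℂ → E} {C D : ℝ}
    (hf : DiffContOnCl ℂ f {z | z.re < 0}) (hg : DiffContOnCl ℂ g {z | z.re < 0})
    (hfC : ∀ z : ℂ, z.re ≤ 0 → ‖f z‖ ≤ C) (hgD : ∀ z : ℂ, z.re ≤ 0 → ‖g z‖ ≤ D)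
    (h : ∀ u : ℝ, f (u * Complex.I) = g (u * Complex.I)) :
    EqOn f g {z | z.re ≤ 0} := by
  intro w hw
  have hneg : DiffContOnCl ℂ (fun z : ℂ => -z) {z | 0 < z.re} :=
    differentiable_neg.diffContOnCl
  have hmaps : MapsTo (fun z : ℂ => -z) {z | 0 < z.re} {z | z.re < 0} := fun z hz => by
    simpa using hz
  have hbound : ∀ z : ℂ, 0 ≤ z.re → ‖f (-z) - g (-z)‖ ≤ C + D := fun z hz =>
    have hz' : (-z).re ≤ 0 := by simpa using hz
    (norm_sub_le _ _).trans (add_le_add (hfC _ hz') (hgD _ hz'))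
  have hzero : ‖f (- -w) - g (- -w)‖ ≤ 0 := by
    refine PhragmenLindelof.right_half_plane_of_bounded_on_real (C := 0) (z := -w)
      ((hf.comp hneg hmaps).sub (hg.comp hneg hmaps)) ⟨1, by norm_num, 0, ?_⟩ ⟨C + D, ?_⟩ ?_
      (by simpa using hw)
    · refine Asymptotics.IsBigO.of_bound (C + D) ?_
      filter_upwards [mem_inf_of_right (mem_principal_self _)] with z hz
      simpa using hbound z (le_of_lt hz)
    · rw [eventually_map]
      filter_upwards [eventually_ge_atTop 0] with t ht using hbound t (by simpa using ht)
    · intro u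
      simpa [sub_eq_zero] using h (-u)
  rw [neg_neg] at hzero
  exact sub_eq_zero.1 (norm_le_zero_iff.1 hzero)

variable {μ ν : Measure ℝ} [IsProbabilityMeasure μ] {x : ℝ}

theorem complexMGF_id_eq_one_add_complexLaplaceExponent (hμ : ∀ᵐ y ∂μ, 0 ≤ y) {w : ℂ}
    (hw : w.re ≤ 0) : complexMGF id μ w = 1 + complexLaplaceExponent μ w := by
  have h := integral_add (integrable_const (1 : ℂ))
    ((IsSubordinatorMeasure.of_isFiniteMeasure hμ).integrable_cexp_mul_sub_one hw)
  simpa [complexMGF, complexLaplaceExponent] using h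

theorem norm_complexMGF_id_le_one (hμ : ∀ᵐ y ∂μ, 0 ≤ y) {w : ℂ} (hw : w.re ≤ 0) :
    ‖complexMGF id μ w‖ ≤ 1 := by
  refine (norm_integral_le_of_norm_le_const (C := 1) ?_).trans (by simp)
  filter_upwards [hμ] with y hy using norm_cexp_mul_le_one hw hy

theorem mgf_id_eq_exp_of_charFun_eq (hμ : ∀ᵐ y ∂μ, 0 ≤ y) (hν : IsSubordinatorMeasure ν)
    (hx : 0 ≤ x)
    (h : ∀ u : ℝ, charFun μ u = Complex.exp (x * complexLaplaceExponent ν (u * Complex.I)))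
    {t : ℝ} (ht : t ≤ 0) :
    mgf id μ t = Real.exp (x * laplaceExponent ν t) := by
  have hμ' := IsSubordinatorMeasure.of_isFiniteMeasure hμ
  have hdiff : DiffContOnCl ℂ (fun w => 1 + complexLaplaceExponent μ w) {w | w.re < 0} :=
    hμ'.diffContOnCl_complexLaplaceExponent.const_add 1
  have hexp : DiffContOnCl ℂ (fun w => Complex.exp (x * complexLaplaceExponent ν w))
      {w | w.re < 0} :=
    Complex.differentiable_exp.comp_diffContOnCl
      (hν.diffContOnCl_complexLaplaceExponent.const_smul (x : ℂ))
  have hnorm (w : ℂ) (hw : w.re ≤ 0) :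
      ‖Complex.exp (x * complexLaplaceExponent ν w)‖ ≤ 1 := by
    rw [Complex.norm_exp, Complex.re_ofReal_mul]
    exact Real.exp_le_one_iff.2 (mul_nonpos_of_nonneg_of_nonpos hx
      (hν.re_complexLaplaceExponent_nonpos hw))
  have heq := eqOn_re_nonpos_of_eqOn_imaginary_axis hdiff hexp
    (fun w hw => by
      rw [← complexMGF_id_eq_one_add_complexLaplaceExponent hμ hw]
      exact norm_complexMGF_id_le_one hμ hw) hnorm
    (fun u => by
      rw [← complexMGF_id_eq_one_add_complexLaplaceExponent hμ (by simp), complexMGF_id_mul_I, h])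
    (show (t : ℂ).re ≤ 0 by simpa using ht)
  beta_reduce at heq
  rw [← complexMGF_id_eq_one_add_complexLaplaceExponent hμ (by simpa using ht),
    complexMGF_ofReal, complexLaplaceExponent_ofReal] at heq
  exact_mod_cast heq

end Uniqueness

section BellPolynomial

open Polynomial

/-- The complete Bell polynomial in the cumulants `x κ₁, …, x κₙ`, as a polynomial in `x`: the sum
over all set partitions of an `n`-set of the product over the blocks `B` of `x κ_{|B|}`. It gives
the moments of a random variable with these cumulants. The recursion splits off the block of a
fixed element. -/
def bellPolynomial {R : Type*} [CommSemiring R] (κ : ℕ → R) : ℕ → R[X]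
  | 0 => 1
  | n + 1 => X * ∑ i : Fin (n + 1), C (n.choose i * κ (i + 1)) * bellPolynomial κ (n - i)
  decreasing_by omega

variable {R : Type*} [CommSemiring R] (κ : ℕ → R)

theorem bellPolynomial_zero : bellPolynomial κ 0 = 1 := by rw [bellPolynomial]

theorem bellPolynomial_succ (n : ℕ) :
    bellPolynomial κ (n + 1) =
      X * ∑ i ∈ Finset.range (n + 1), C (n.choose i * κ (i + 1)) * bellPolynomial κ (n - i) := by
  rw [bellPolynomial, Finset.sum_range]

theorem bellPolynomial_coeff_zero {n : ℕ} (hn : n ≠ 0) : (bellPolynomial κ n).coeff 0 = 0 := by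
  obtain ⟨n, rfl⟩ := Nat.exists_eq_succ_of_ne_zero hn
  rw [Nat.succ_eq_add_one, bellPolynomial_succ, coeff_X_mul_zero]

theorem bellPolynomial_coeff_one {n : ℕ} (hn : n ≠ 0) : (bellPolynomial κ n).coeff 1 = κ n := by
  obtain ⟨n, rfl⟩ := Nat.exists_eq_succ_of_ne_zero hn
  have hlower : ∀ i ∈ Finset.range n,
      (n.choose i * κ (i + 1)) * (bellPolynomial κ (n - i)).coeff 0 = 0 := fun i hi => by
    rw [bellPolynomial_coeff_zero κ (Nat.sub_ne_zero_of_lt (Finset.mem_range.1 hi)), mul_zero]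
  rw [Nat.succ_eq_add_one, bellPolynomial_succ, coeff_X_mul, finsetSum_coeff]
  simp only [coeff_C_mul]
  rw [Finset.sum_range_succ, Finset.sum_eq_zero hlower]
  simp [bellPolynomial_zero]

theorem mul_eval_divX_bellPolynomial {n : ℕ} (hn : n ≠ 0) (x : R) :
    x * (bellPolynomial κ n).divX.eval x = (bellPolynomial κ n).eval x := by
  conv_rhs => rw [← (bellPolynomial κ n).X_mul_divX_add, bellPolynomial_coeff_zero κ hn]
  simp

theorem eval_zero_divX_bellPolynomial {n : ℕ} (hn : n ≠ 0) :
    (bellPolynomial κ n).divX.eval 0 = κ n := by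
  rw [← coeff_zero_eq_eval_zero, coeff_divX, zero_add, bellPolynomial_coeff_one κ hn]

end BellPolynomial

section TiltedMoments

variable {μ ν : Measure ℝ} [IsProbabilityMeasure μ] {x : ℝ}

theorem Iio_subset_interior_integrableExpSet_id (hμ : ∀ᵐ y ∂μ, 0 ≤ y) :
    Iio 0 ⊆ interior (integrableExpSet id μ) := by
  refine interior_maximal (fun t (ht : t < 0) => ?_) isOpen_Iio
  refine (integrable_const (1 : ℝ)).mono' (by fun_prop) ?_
  filter_upwards [hμ] with y hy
  rw [Real.norm_of_nonneg (by positivity)]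
  exact Real.exp_le_one_iff.2 (mul_nonpos_of_nonpos_of_nonneg ht.le hy)

theorem iteratedDeriv_mgf_id (hμ : ∀ᵐ y ∂μ, 0 ≤ y) (n : ℕ) :
    iteratedDeriv n (mgf id μ) (-1) = tiltedMoment μ n := by
  rw [iteratedDeriv_mgf (Iio_subset_interior_integrableExpSet_id hμ (by simp))]
  simp [tiltedMoment]

theorem tiltedMoment_succ (hμ : ∀ᵐ y ∂μ, 0 ≤ y) (hν : IsSubordinatorMeasure ν)
    (h : ∀ t ≤ 0, mgf id μ t = Real.exp (x * laplaceExponent ν t)) (n : ℕ) :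
    tiltedMoment μ (n + 1) =
      x * ∑ i ∈ Finset.range (n + 1),
        n.choose i * tiltedMoment ν (i + 1) * tiltedMoment μ (n - i) := by
  have hmem : (-1 : ℝ) ∈ Iio 0 := by simp
  have hderiv : deriv (mgf id μ) =ᶠ[𝓝 (-1)] x • (mgf id (sizeBiased ν) * mgf id μ) := by
    filter_upwards [isOpen_Iio.mem_nhds hmem] with t ht
    have hlocal : mgf id μ =ᶠ[𝓝 t] fun t => Real.exp (x * laplaceExponent ν t) := by
      filter_upwards [isOpen_Iio.mem_nhds ht] with s hs using h s (le_of_lt hs)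
    rw [hlocal.deriv_eq, (((hν.hasDerivAt_laplaceExponent ht).const_mul x).exp).deriv]
    simp only [Pi.smul_apply, Pi.mul_apply, smul_eq_mul, h t (le_of_lt ht)]
    ring
  rw [← iteratedDeriv_mgf_id hμ, iteratedDeriv_succ', hderiv.iteratedDeriv_eq,
    iteratedDeriv_const_smul_field, iteratedDeriv_mul
      (analyticAt_mgf (hν.Iio_subset_interior_integrableExpSet_sizeBiased hmem)).contDiffAt
      (analyticAt_mgf (Iio_subset_interior_integrableExpSet_id hμ hmem)).contDiffAt]
  simp only [hν.iteratedDeriv_mgf_sizeBiased, iteratedDeriv_mgf_id hμ, smul_eq_mul]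

theorem tiltedMoment_eq_exp_mul_eval_bellPolynomial (hμ : ∀ᵐ y ∂μ, 0 ≤ y)
    (hν : IsSubordinatorMeasure ν)
    (h : ∀ t ≤ 0, mgf id μ t = Real.exp (x * laplaceExponent ν t)) (n : ℕ) :
    tiltedMoment μ n =
      Real.exp (x * laplaceExponent ν (-1)) * (bellPolynomial (tiltedMoment ν) n).eval x := by
  induction n using Nat.strong_induction_on with
  | _ n ih =>
    rcases n with _ | n
    · simp [← h (-1) (by simp), mgf, tiltedMoment, bellPolynomial_zero]
    · rw [tiltedMoment_succ hμ hν h, bellPolynomial_succ, Polynomial.eval_mul, Polynomial.eval_X,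
        Polynomial.eval_finsetSum, Finset.mul_sum, Finset.mul_sum, Finset.mul_sum]
      refine Finset.sum_congr rfl fun i _ => ?_
      rw [ih (n - i) (by omega), Polynomial.eval_mul, Polynomial.eval_C]
      ring

end TiltedMoments

section KernelClass

variable {ι α β γ : Type*}

/-- The tuples in `α^ι` whose coordinates coincide exactly where those of `d` do. -/
def kernelClass (α : Type*) (d : ι → β) : Set (ι → α) :=
  {x | ∀ i j, x i = x j ↔ d i = d j}

theorem mem_kernelClass {d : ι → β} {x : ι → α} :
    x ∈ kernelClass α d ↔ ∀ i j, x i = x j ↔ d i = d j :=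
  Iff.rfl

theorem mem_kernelClass_id {x : ι → α} : x ∈ kernelClass α id ↔ Function.Injective x :=
  forall₂_congr fun _ _ => ⟨fun h => h.1, fun h => ⟨@h, congrArg x⟩⟩

theorem comp_mem_kernelClass_iff {d : ι → β} {x : ι → γ} {f : γ → α}
    (hf : InjOn f (range x)) : f ∘ x ∈ kernelClass α d ↔ x ∈ kernelClass γ d := by
  simp only [mem_kernelClass, Function.comp_apply, hf.eq_iff (mem_range_self _) (mem_range_self _)]

theorem comp_mem_kernelClass {b : β → α} (hb : Function.Injective b) (d : ι → β) :
    b ∘ d ∈ kernelClass α d :=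
  fun _ _ => hb.eq_iff

theorem kernelClass_comp {f : β → γ} (hf : Function.Injective f) (d : ι → β) :
    kernelClass α (f ∘ d) = kernelClass α d := by
  simp only [kernelClass, Function.comp_apply, hf.eq_iff]

open Classical in
theorem sum_kernelClass_eq_sum_injective [Fintype ι] [Fintype α] [Fintype β]
    {M : Type*} [AddCommMonoid M] {d : ι → β} (hd : Function.Surjective d) (F : (ι → α) → M) :
    ∑ x with x ∈ kernelClass α d, F x = ∑ b : β → α with Function.Injective b, F (b ∘ d) := by
  symm
  refine Finset.sum_nbij (· ∘ d) ?_ ?_ ?_ fun _ _ => rfl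
  · intro b hb
    simpa using comp_mem_kernelClass (Finset.mem_filter.1 hb).2 d
  · exact fun b _ b' _ h => hd.injective_comp_right h
  · intro x hx
    have hx' : x ∈ kernelClass α d := by simpa using hx
    obtain ⟨e, he⟩ := hd.hasRightInverse
    have hxe : (x ∘ e) ∘ d = x := funext fun i => (hx' _ _).2 (he (d i))
    refine ⟨x ∘ e, ?_, hxe⟩
    simp only [Finset.coe_filter, Finset.mem_univ, true_and, mem_ofPred]
    intro j k hjk
    simpa only [he j, he k] using (hx' (e j) (e k)).1 hjk

end KernelClass

section SeparatingSequence

/-- A sequence of maps, to be thought of as partitions of `Ω`, such that any two points are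
eventually in different cells. -/
structure IsSeparatingSequence {Ω : Type*} [MeasurableSpace Ω] {α : ℕ → Type*}
    [∀ N, MeasurableSpace (α N)] (g : ∀ N, Ω → α N) : Prop where
  measurable : ∀ N, Measurable (g N)
  eventually_ne : ∀ x y, x ≠ y → ∀ᶠ N in atTop, g N x ≠ g N y

variable {Ω : Type*} [MeasurableSpace Ω]

theorem exists_isSeparatingSequence [MeasurableSpace.CountablySeparated Ω] :
    ∃ g : ∀ N, Ω → (Fin N → Bool), IsSeparatingSequence g := by
  obtain ⟨f, hf, hinj⟩ := MeasurableSpace.measurable_injection_nat_bool_of_countablySeparated Ω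
  refine ⟨fun N x i => f x i, fun N => by fun_prop, fun x y hxy => ?_⟩
  obtain ⟨k, hk⟩ := Function.ne_iff.1 (hinj.ne hxy)
  filter_upwards [eventually_gt_atTop k] with N hN h using hk (congrFun h ⟨k, hN⟩)

theorem measurableEq_of_countablySeparated [MeasurableSpace.CountablySeparated Ω] :
    MeasurableEq Ω := by
  obtain ⟨f, hf, hinj⟩ := MeasurableSpace.measurable_injection_nat_bool_of_countablySeparated Ω
  refine ⟨?_⟩
  convert! measurableSet_eq_fun (hf.comp measurable_fst) (hf.comp measurable_snd) using 1
  ext ⟨x, y⟩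
  simp [hinj.eq_iff]

theorem measurable_postcomp {α J : Type*} [MeasurableSpace α] {g : Ω → α} (hg : Measurable g) :
    Measurable fun y : J → Ω => g ∘ y :=
  measurable_pi_lambda _ fun j => hg.comp (measurable_pi_apply j)

namespace IsSeparatingSequence

variable {α : ℕ → Type*} [∀ N, MeasurableSpace (α N)] {g : ∀ N, Ω → α N}

theorem eventually_comp_mem_kernelClass_iff (hg : IsSeparatingSequence g)
    {ι β : Type*} [Finite ι]
    (d : ι → β) (x : ι → Ω) :
    ∀ᶠ N in atTop, g N ∘ x ∈ kernelClass (α N) d ↔ x ∈ kernelClass Ω d := by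
  have hpair (i j : ι) : ∀ᶠ N in atTop, g N (x i) = g N (x j) ↔ x i = x j := by
    by_cases hij : x i = x j
    · simp [hij]
    · filter_upwards [hg.eventually_ne _ _ hij] with N hN using iff_of_false hN hij
  filter_upwards [eventually_all.2 fun i => eventually_all.2 (hpair i)] with N hN
  simp only [mem_kernelClass, Function.comp_apply, hN]

variable [∀ N, MeasurableSingletonClass (α N)]

theorem tendsto_measureReal_kernelClass [∀ N, Finite (α N)] (hg : IsSeparatingSequence g)
    {ι β : Type*} [Finite ι]
    (d : ι → β) (μ : Measure (ι → Ω)) [IsFiniteMeasure μ] :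
    Tendsto (fun N => μ.real {x | g N ∘ x ∈ kernelClass (α N) d}) atTop
      (𝓝 (μ.real (kernelClass Ω d))) := by
  refine (ENNReal.tendsto_toReal (measure_ne_top _ _)).comp
    (tendsto_measure_of_tendsto_indicator_of_isFiniteMeasure _ μ (fun N => ?_)
      (hg.eventually_comp_mem_kernelClass_iff d))
  exact measurable_postcomp (hg.measurable N) (.of_discrete (s := kernelClass (α N) d))

theorem tendsto_measureReal_cell (hg : IsSeparatingSequence g) (μ : Measure Ω) [IsFiniteMeasure μ]
    (y : Ω) : Tendsto (fun N => μ.real (g N ⁻¹' {g N y})) atTop (𝓝 (μ.real {y})) := by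
  refine (ENNReal.tendsto_toReal (measure_ne_top _ _)).comp
    (tendsto_measure_of_tendsto_indicator_of_isFiniteMeasure _ μ
      (fun N => hg.measurable N (measurableSet_singleton _)) fun x => ?_)
  by_cases hxy : x = y
  · simp [hxy]
  · filter_upwards [hg.eventually_ne _ _ hxy] with N hN using iff_of_false hN hxy

end IsSeparatingSequence

theorem ae_injective_pi [MeasurableEq Ω] {J : Type*} [Fintype J] (μ : Measure Ω) [SigmaFinite μ]
    [NullSingletonClass μ] : ∀ᵐ y ∂Measure.pi (fun _ : J => μ), Function.Injective y := by
  classical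
  have hpair (j k : J) (hjk : j ≠ k) : ∀ᵐ y ∂Measure.pi (fun _ : J => μ), y j ≠ y k := by
    have hmeas : MeasurableSet {y : J → Ω | y j = y k} :=
      measurableSet_eq_fun (measurable_pi_apply j) (measurable_pi_apply k)
    rw [ae_iff]
    simp only [ne_eq, not_not]
    rcases isEmpty_or_nonempty (J → Ω) with hempty | ⟨⟨y₀⟩⟩
    · rw [eq_empty_of_isEmpty {y : J → Ω | y j = y k}, measure_empty]
    rw [← lintegral_indicator_one hmeas, lintegral_eq_lmarginal_univ y₀,
      lmarginal_erase' _ (measurable_one.indicator hmeas) (Finset.mem_univ j)]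
    have hinner (y : J → Ω) : ∫⁻ a, {y : J → Ω | y j = y k}.indicator 1
        (Function.update y j a) ∂μ = 0 := by
      have hset : (fun a => {y : J → Ω | y j = y k}.indicator (1 : (J → Ω) → ENNReal)
          (Function.update y j a)) = ({y k} : Set Ω).indicator 1 := by
        ext a
        simp [indicator, hjk.symm]
      rw [hset, lintegral_indicator_one (measurableSet_singleton _), measure_singleton]
    simp [hinner, lmarginal]
  filter_upwards [ae_all_iff.2 fun j => ae_all_iff.2 fun k => ae_all_iff.2 (hpair j k)] with y hy
  exact fun j k hjk => by_contra fun hne => hy j k hne hjk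

theorem map_postcomp_pi {α J : Type*} [MeasurableSpace α] [Fintype J] (μ : Measure Ω) {g : Ω → α}
    [SigmaFinite (μ.map g)] (hg : Measurable g) :
    (Measure.pi fun _ : J => μ).map (fun y => g ∘ y) = Measure.pi fun _ => μ.map g :=
  Measure.pi_map_pi fun _ => hg.aemeasurable

theorem measureReal_pi_singleton {J : Type*} [Fintype J] (μ : Measure Ω) [SigmaFinite μ]
    (y : J → Ω) : (Measure.pi fun _ : J => μ).real {y} = ∏ j, μ.real {y j} := by
  rw [measureReal_def, Measure.pi_singleton, ENNReal.toReal_prod]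
  rfl

theorem measureReal_pi_univ {J : Type*} [Fintype J] (μ : Measure Ω) [SigmaFinite μ] :
    (Measure.pi fun _ : J => μ).real univ = μ.real univ ^ Fintype.card J := by
  simp [measureReal_def, Measure.pi_univ]

theorem integral_postcomp_pi_eq_sum {α J : Type*} [Fintype α] [MeasurableSpace α]
    [MeasurableSingletonClass α] [Fintype J] [DecidableEq J] (μ : Measure Ω) [IsFiniteMeasure μ]
    {g : Ω → α} (hg : Measurable g) (F : (J → α) → ℝ) :
    ∫ y, F (g ∘ y) ∂Measure.pi (fun _ : J => μ) =
      ∑ b : J → α, (∏ j, μ.real (g ⁻¹' {b j})) * F b := by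
  rw [← integral_map (φ := fun y => g ∘ y) (measurable_postcomp hg).aemeasurable (by fun_prop),
    map_postcomp_pi μ hg, integral_fintype .of_finite]
  simp only [measureReal_pi_singleton, smul_eq_mul,
    map_measureReal_apply hg (measurableSet_singleton _)]

open Classical in
theorem measureReal_pi_postcomp_mem_eq_sum {α J : Type*} [Fintype α] [MeasurableSpace α]
    [MeasurableSingletonClass α] [Fintype J] (μ : Measure Ω) [IsFiniteMeasure μ]
    {g : Ω → α} (hg : Measurable g) (A : Set (J → α)) :
    (Measure.pi fun _ : J => μ).real {y | g ∘ y ∈ A} =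
      ∑ b : J → α with b ∈ A, ∏ j, μ.real (g ⁻¹' {b j}) := by
  have h := integral_postcomp_pi_eq_sum (J := J) μ hg (A.indicator 1)
  have hmeas : MeasurableSet {y : J → Ω | g ∘ y ∈ A} := measurable_postcomp hg .of_discrete
  rw [← integral_indicator_one hmeas, Finset.sum_filter]
  simpa [indicator] using h

namespace IsSeparatingSequence

variable {α : ℕ → Type*} [∀ N, MeasurableSpace (α N)] {g : ∀ N, Ω → α N}
  [∀ N, MeasurableSingletonClass (α N)]

theorem tendsto_prod_measureReal_cell (hg : IsSeparatingSequence g) {J : Type*} [Fintype J]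
    (μ : Measure Ω) [IsFiniteMeasure μ] [NullSingletonClass μ] {q : J → ℝ → ℝ}
    (hq : ∀ j, Continuous (q j)) (y : J → Ω) :
    Tendsto (fun N => ∏ j, q j (μ.real (g N ⁻¹' {g N (y j)}))) atTop (𝓝 (∏ j, q j 0)) := by
  have hcell (j : J) : Tendsto (fun N => μ.real (g N ⁻¹' {g N (y j)})) atTop (𝓝 0) := by
    simpa [measureReal_def] using hg.tendsto_measureReal_cell μ (y j)
  exact tendsto_finsetProd _ fun j _ => ((hq j).tendsto 0).comp (hcell j)

open Classical in
theorem tendsto_integral_injective_prod [∀ N, Finite (α N)] (hg : IsSeparatingSequence g)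
    [MeasurableEq Ω] {J : Type*} [Fintype J] (μ : Measure Ω) [IsFiniteMeasure μ]
    [NullSingletonClass μ] {q : J → ℝ → ℝ} (hq : ∀ j, Continuous (q j)) :
    Tendsto (fun N => ∫ y, if Function.Injective (g N ∘ y) then
        ∏ j, q j (μ.real (g N ⁻¹' {g N (y j)})) else 0 ∂Measure.pi (fun _ : J => μ)) atTop
      (𝓝 (∏ j, μ.real univ * q j 0)) := by
  have hlim : ∏ j, μ.real univ * q j 0 = ∫ _, ∏ j, q j 0 ∂Measure.pi (fun _ : J => μ) := by
    rw [integral_const, measureReal_pi_univ, Finset.prod_mul_distrib, Finset.prod_const,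
      smul_eq_mul, Finset.card_univ]
  choose C hC using fun j => isCompact_Icc.exists_bound_of_continuousOn
    (hq j).continuousOn (s := Icc 0 (μ.real univ))
  have hcell (N : ℕ) (a : α N) : μ.real (g N ⁻¹' {a}) ∈ Icc 0 (μ.real univ) :=
    ⟨measureReal_nonneg, measureReal_mono (subset_univ _)⟩
  have hC0 (j : J) : 0 ≤ C j := (norm_nonneg _).trans (hC j 0 ⟨le_rfl, measureReal_nonneg⟩)
  rw [hlim]
  refine tendsto_integral_of_dominated_convergence (fun _ => ∏ j, C j) (fun N => ?_)
    (integrable_const _) (fun N => Eventually.of_forall fun y => ?_) ?_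
  · exact ((measurable_of_finite fun b : J → α N => if Function.Injective b then
      ∏ j, q j (μ.real (g N ⁻¹' {b j})) else 0).comp
        (measurable_postcomp (hg.measurable N))).aestronglyMeasurable
  · split_ifs
    · rw [norm_prod]
      exact Finset.prod_le_prod (fun _ _ => norm_nonneg _) fun j _ => hC j _ (hcell N _)
    · simpa using Finset.prod_nonneg fun j _ => hC0 j
  · filter_upwards [ae_injective_pi μ] with y hy
    refine (hg.tendsto_prod_measureReal_cell μ hq y).congr' ?_
    filter_upwards [hg.eventually_comp_mem_kernelClass_iff id y] with N hN
    rw [mem_kernelClass_id, mem_kernelClass_id] at hN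
    rw [if_pos (hN.2 hy)]

variable [∀ N, Fintype (α N)]

open Classical in
theorem tendsto_sum_injective_prod (hg : IsSeparatingSequence g) [MeasurableEq Ω] {J : Type*}
    [Fintype J] (μ : Measure Ω) [IsFiniteMeasure μ] [NullSingletonClass μ] {q : J → ℝ → ℝ}
    (hq : ∀ j, Continuous (q j)) :
    Tendsto (fun N => ∑ b : J → α N with Function.Injective b,
        ∏ j, μ.real (g N ⁻¹' {b j}) * q j (μ.real (g N ⁻¹' {b j}))) atTop
      (𝓝 (∏ j, μ.real univ * q j 0)) := by
  refine (hg.tendsto_integral_injective_prod μ hq).congr fun N => ?_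
  have hsum := integral_postcomp_pi_eq_sum μ (hg.measurable N) fun b : J → α N =>
    if Function.Injective b then ∏ j, q j (μ.real (g N ⁻¹' {b j})) else 0
  simp only [Function.comp_apply, mul_ite, mul_zero, ← Finset.prod_mul_distrib] at hsum
  rw [hsum, Finset.sum_filter]

end IsSeparatingSequence

end SeparatingSequence

section CompletelyRandomMeasure

theorem sFinite_of_lintegral_ne_top {α : Type*} [MeasurableSpace α] {μ : Measure α}
    {f : α → ENNReal} (hf : AEMeasurable f μ) (hpos : ∀ᵐ x ∂μ, f x ≠ 0)
    (hint : ∫⁻ x, f x ∂μ ≠ ⊤) : SFinite μ :=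
  have := isFiniteMeasure_withDensity hint
  sFinite_of_absolutelyContinuous (withDensity_absolutelyContinuous' hf hpos)

theorem sFinite_restrict_Ioi {ρ : Measure ℝ}
    (hρ : ∫⁻ r in Ioi (0 : ℝ), ENNReal.ofReal (min 1 r) ∂ρ < ⊤) :
    SFinite (ρ.restrict (Ioi 0)) :=
  sFinite_of_lintegral_ne_top (by fun_prop)
    ((ae_restrict_mem measurableSet_Ioi).mono fun r hr => by simpa using hr) hρ.ne

theorem measureReal_univ_eq_sum_preimage_singleton {Ω α : Type*} [MeasurableSpace Ω] [Fintype α]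
    [MeasurableSpace α] [MeasurableSingletonClass α] (μ : Measure Ω) [IsFiniteMeasure μ]
    {g : Ω → α} (hg : Measurable g) : μ.real univ = ∑ a, μ.real (g ⁻¹' {a}) := by
  simpa using (sum_measureReal_preimage_singleton (μ := μ) Finset.univ
    fun a _ => hg (measurableSet_singleton a)).symm

theorem exp_neg_mul_measureReal_pi_le_factorial {Ω ι : Type*} [MeasurableSpace Ω] [Fintype ι]
    (μ : Measure Ω) [IsFiniteMeasure μ] (A : Set (ι → Ω)) :
    Real.exp (-μ.real univ) * (Measure.pi fun _ => μ).real A ≤ (Fintype.card ι).factorial := by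
  calc Real.exp (-μ.real univ) * (Measure.pi fun _ => μ).real A
      ≤ Real.exp (-μ.real univ) * μ.real univ ^ Fintype.card ι := by
        rw [← measureReal_pi_univ]
        exact mul_le_mul_of_nonneg_left (measureReal_mono (subset_univ A)) (Real.exp_nonneg _)
    _ ≤ (Fintype.card ι).factorial := by
        rw [mul_comm]
        exact pow_mul_exp_neg_le_factorial _ measureReal_nonneg

variable {S Ω : Type*} [MeasurableSpace S] [MeasurableSpace Ω] {P : Measure S} {G : S → Measure Ω}

namespace IsCompletelyRandomMeasure

section Independence

variable {κ : Measure (ℝ × Ω)}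

theorem ae_isFiniteMeasure (hG : IsCompletelyRandomMeasure P G κ) :
    ∀ᵐ s ∂P, IsFiniteMeasure (G s) :=
  hG.finite.mono fun _ hs => ⟨hs⟩

theorem measurable_measureReal (hG : IsCompletelyRandomMeasure P G κ) {A : Set Ω}
    (hA : MeasurableSet A) : Measurable fun s => (G s).real A :=
  ((Measure.measurable_coe hA).comp hG.measurable).ennreal_toReal

theorem iIndepFun_measureReal_preimage_singleton (hG : IsCompletelyRandomMeasure P G κ)
    {α : Type*} [Finite α] [MeasurableSpace α] [MeasurableSingletonClass α] {g : Ω → α}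
    (hg : Measurable g) : iIndepFun (fun a s => (G s).real (g ⁻¹' {a})) P := by
  let e := Finite.equivFin α
  have hfin := hG.indep (Nat.card α) (fun i => g ⁻¹' {e.symm i})
    (fun i => hg (measurableSet_singleton _)) fun i j hij =>
      (disjoint_singleton.2 (e.symm.injective.ne hij)).preimage g
  have h := (hfin.precomp e.injective).comp (fun _ x => x.toReal) fun _ => ENNReal.measurable_toReal
  simpa [Function.comp_def] using! h

theorem integrable_exp_neg_mul_measureReal_pi (hG : IsCompletelyRandomMeasure P G κ)
    [IsFiniteMeasure P] {α ι : Type*} [Finite α] [MeasurableSpace α] [MeasurableSingletonClass α]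
    [Fintype ι] {g : Ω → α} (hg : Measurable g) (A : Set (ι → α)) :
    Integrable (fun s => Real.exp (-(G s).real univ) *
      (Measure.pi fun _ => G s).real {y | g ∘ y ∈ A}) P := by
  classical
  have := Fintype.ofFinite α
  have hae : (fun s => Real.exp (-(G s).real univ) *
      (Measure.pi fun _ => G s).real {y | g ∘ y ∈ A}) =ᵐ[P] fun s => Real.exp (-(G s).real univ) *
        ∑ x : ι → α with x ∈ A, ∏ i, (G s).real (g ⁻¹' {x i}) := by
    filter_upwards [hG.ae_isFiniteMeasure] with s hs
    rw [measureReal_pi_postcomp_mem_eq_sum (G s) hg]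
  have huniv := hG.measurable_measureReal .univ
  have hcell (a : α) := hG.measurable_measureReal (hg (measurableSet_singleton a))
  refine (integrable_const ((Fintype.card ι).factorial : ℝ)).mono'
    (AEStronglyMeasurable.congr (by fun_prop) hae.symm) ?_
  filter_upwards [hG.ae_isFiniteMeasure] with s hs
  rw [Real.norm_of_nonneg (by positivity)]
  exact exp_neg_mul_measureReal_pi_le_factorial (G s) _

end Independence

variable {ν : Measure ℝ} {G₀ : Measure Ω} [SFinite ν] [IsFiniteMeasure G₀]

theorem charFun_map_measureReal (hG : IsCompletelyRandomMeasure P G (ν.prod G₀)) {A : Set Ω}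
    (hA : MeasurableSet A) (u : ℝ) :
    MeasureTheory.charFun (P.map fun s => (G s).real A) u =
      Complex.exp (G₀.real A * complexLaplaceExponent ν (u * Complex.I)) := by
  have hexponent : ∫ x in univ ×ˢ A, (Complex.exp (Complex.I * u * (x.1 : ℂ)) - 1) ∂ν.prod G₀ =
      G₀.real A * complexLaplaceExponent ν (u * Complex.I) := by
    rw [← Measure.prod_restrict, Measure.restrict_univ,
      integral_fun_fst (fun r : ℝ => Complex.exp (Complex.I * u * (r : ℂ)) - 1)]
    simp [complexLaplaceExponent, mul_comm]
  rw [← hexponent, ← hG.charFun A hA, charFun_apply_real,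
    integral_map (hG.measurable_measureReal hA).aemeasurable (by fun_prop)]
  simp only [measureReal_def, mul_comm, mul_assoc]

variable [IsProbabilityMeasure P]

theorem mgf_id_map_measureReal (hG : IsCompletelyRandomMeasure P G (ν.prod G₀))
    (hν : IsSubordinatorMeasure ν) {A : Set Ω} (hA : MeasurableSet A) {t : ℝ} (ht : t ≤ 0) :
    mgf id (P.map fun s => (G s).real A) t = Real.exp (G₀.real A * laplaceExponent ν t) := by
  have hmeas := (hG.measurable_measureReal hA).aemeasurable (μ := P)
  have := Measure.isProbabilityMeasure_map hmeas
  exact mgf_id_eq_exp_of_charFun_eq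
    ((ae_map_iff hmeas measurableSet_Ici).2 (.of_forall fun _ => measureReal_nonneg)) hν
    measureReal_nonneg (hG.charFun_map_measureReal hA) ht

theorem integral_exp_mul_measureReal (hG : IsCompletelyRandomMeasure P G (ν.prod G₀))
    (hν : IsSubordinatorMeasure ν) {A : Set Ω} (hA : MeasurableSet A) {t : ℝ} (ht : t ≤ 0) :
    ∫ s, Real.exp (t * (G s).real A) ∂P = Real.exp (G₀.real A * laplaceExponent ν t) := by
  rw [← hG.mgf_id_map_measureReal hν hA ht,
    mgf_id_map (hG.measurable_measureReal hA).aemeasurable, mgf]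

theorem integral_pow_mul_exp_neg_measureReal (hG : IsCompletelyRandomMeasure P G (ν.prod G₀))
    (hν : IsSubordinatorMeasure ν) {A : Set Ω} (hA : MeasurableSet A) (n : ℕ) :
    ∫ s, (G s).real A ^ n * Real.exp (-(G s).real A) ∂P =
      Real.exp (G₀.real A * laplaceExponent ν (-1)) *
        (bellPolynomial (tiltedMoment ν) n).eval (G₀.real A) := by
  have hmeas := (hG.measurable_measureReal hA).aemeasurable (μ := P)
  have := Measure.isProbabilityMeasure_map hmeas
  rw [← tiltedMoment_eq_exp_mul_eval_bellPolynomial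
    ((ae_map_iff hmeas measurableSet_Ici).2 (.of_forall fun _ => measureReal_nonneg)) hν
    (fun t ht => hG.mgf_id_map_measureReal hν hA ht) n, tiltedMoment,
    integral_map hmeas (by fun_prop)]

section Partition

variable {α : Type*} [MeasurableSpace α] [MeasurableSingletonClass α] {g : Ω → α}

theorem integral_exp_neg_mul_prod_pow [Fintype α]
    (hG : IsCompletelyRandomMeasure P G (ν.prod G₀)) (hν : IsSubordinatorMeasure ν)
    (hg : Measurable g) (n : α → ℕ) :
    ∫ s, Real.exp (-(G s).real univ) * ∏ a, (G s).real (g ⁻¹' {a}) ^ n a ∂P =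
      Real.exp (G₀.real univ * laplaceExponent ν (-1)) *
        ∏ a, (bellPolynomial (tiltedMoment ν) (n a)).eval (G₀.real (g ⁻¹' {a})) := by
  have hcell (a : α) : MeasurableSet (g ⁻¹' {a}) := hg (measurableSet_singleton a)
  have hindep : iIndepFun (fun a s => (G s).real (g ⁻¹' {a}) ^ n a *
      Real.exp (-(G s).real (g ⁻¹' {a}))) P :=
    (hG.iIndepFun_measureReal_preimage_singleton hg).comp
      (fun a x => x ^ n a * Real.exp (-x)) fun a => by fun_prop
  calc ∫ s, Real.exp (-(G s).real univ) * ∏ a, (G s).real (g ⁻¹' {a}) ^ n a ∂P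
      = ∫ s, ∏ a, (G s).real (g ⁻¹' {a}) ^ n a * Real.exp (-(G s).real (g ⁻¹' {a})) ∂P := by
        refine integral_congr_ae (hG.ae_isFiniteMeasure.mono fun s hs => ?_)
        beta_reduce
        rw [measureReal_univ_eq_sum_preimage_singleton (G s) hg, ← Finset.sum_neg_distrib,
          Real.exp_sum, Finset.prod_mul_distrib, mul_comm]
    _ = ∏ a, ∫ s, (G s).real (g ⁻¹' {a}) ^ n a * Real.exp (-(G s).real (g ⁻¹' {a})) ∂P := by
        refine hindep.integral_fun_prod_eq_prod_integral fun a => ?_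
        have := hG.measurable_measureReal (hcell a)
        fun_prop
    _ = _ := by
        simp only [hG.integral_pow_mul_exp_neg_measureReal hν (hcell _)]
        rw [Finset.prod_mul_distrib, ← Real.exp_sum, ← Finset.sum_mul,
          ← measureReal_univ_eq_sum_preimage_singleton G₀ hg]

open Classical in
theorem integral_exp_neg_mul_prod_comp [Finite α]
    (hG : IsCompletelyRandomMeasure P G (ν.prod G₀)) (hν : IsSubordinatorMeasure ν)
    (hg : Measurable g) {ι J : Type*} [Fintype ι] [Fintype J] (d : ι → J) {b : J → α}
    (hb : Function.Injective b) :
    ∫ s, Real.exp (-(G s).real univ) * ∏ i, (G s).real (g ⁻¹' {b (d i)}) ∂P =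
      Real.exp (G₀.real univ * laplaceExponent ν (-1)) *
        ∏ j, (bellPolynomial (tiltedMoment ν) {i | d i = j}.ncard).eval
          (G₀.real (g ⁻¹' {b j})) := by
  cases nonempty_fintype α
  have hprod (s : S) : ∏ i, (G s).real (g ⁻¹' {b (d i)}) =
      ∏ a, (G s).real (g ⁻¹' {a}) ^ {i | b (d i) = a}.ncard := by
    rw [← Finset.prod_fiberwise' _ (fun i => b (d i)) fun a => (G s).real (g ⁻¹' {a})]
    simp [Finset.prod_const, ncard_eq_toFinset_card']
  simp only [hprod]
  rw [hG.integral_exp_neg_mul_prod_pow hν hg]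
  congr 1
  refine (Fintype.prod_of_injective b hb _ _ (fun a ha => ?_) fun j => ?_).symm
  · have hempty : {i | b (d i) = a} = ∅ :=
      eq_empty_of_forall_notMem fun i hi => ha ⟨d i, hi⟩
    simp [hempty, bellPolynomial_zero]
  · simp only [hb.eq_iff]

variable [Fintype α]

open Classical in
theorem integral_exp_neg_mul_measureReal_pi_postcomp_kernelClass
    (hG : IsCompletelyRandomMeasure P G (ν.prod G₀)) (hν : IsSubordinatorMeasure ν)
    (hg : Measurable g) {ι J : Type*} [Fintype ι] [Fintype J] {d : ι → J}
    (hd : Function.Surjective d) :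
    ∫ s, Real.exp (-(G s).real univ) *
        (Measure.pi fun _ => G s).real {y | g ∘ y ∈ kernelClass α d} ∂P =
      Real.exp (G₀.real univ * laplaceExponent ν (-1)) *
        ∑ b : J → α with Function.Injective b,
          ∏ j, (bellPolynomial (tiltedMoment ν) {i | d i = j}.ncard).eval
            (G₀.real (g ⁻¹' {b j})) := by
  have hint (b : J → α) : Integrable (fun s =>
      Real.exp (-(G s).real univ) * ∏ i, (G s).real (g ⁻¹' {b (d i)})) P := by
    refine (hG.integrable_exp_neg_mul_measureReal_pi hg {b ∘ d}).congr ?_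
    filter_upwards [hG.ae_isFiniteMeasure] with s hs
    rw [measureReal_pi_postcomp_mem_eq_sum (G s) hg {b ∘ d}]
    simp [Finset.filter_eq']
  calc ∫ s, Real.exp (-(G s).real univ) *
        (Measure.pi fun _ => G s).real {y | g ∘ y ∈ kernelClass α d} ∂P
      = ∫ s, ∑ b : J → α with Function.Injective b,
          Real.exp (-(G s).real univ) * ∏ i, (G s).real (g ⁻¹' {b (d i)}) ∂P := by
        refine integral_congr_ae (hG.ae_isFiniteMeasure.mono fun s hs => ?_)
        beta_reduce
        rw [measureReal_pi_postcomp_mem_eq_sum (G s) hg, sum_kernelClass_eq_sum_injective hd,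
          Finset.mul_sum]
        rfl
    _ = ∑ b : J → α with Function.Injective b,
          ∫ s, Real.exp (-(G s).real univ) * ∏ i, (G s).real (g ⁻¹' {b (d i)}) ∂P :=
        integral_finsetSum _ fun b _ => hint b
    _ = _ := by
        rw [Finset.mul_sum]
        refine Finset.sum_congr rfl fun b hb => ?_
        exact hG.integral_exp_neg_mul_prod_comp hν hg d (Finset.mem_filter.1 hb).2

end Partition

theorem integral_exp_neg_mul_measureReal_pi_kernelClass
    [MeasurableSpace.CountablySeparated Ω] [NullSingletonClass G₀]
    (hG : IsCompletelyRandomMeasure P G (ν.prod G₀)) (hν : IsSubordinatorMeasure ν)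
    {ι J : Type*} [Fintype ι] [Fintype J] {d : ι → J} (hd : Function.Surjective d) :
    ∫ s, Real.exp (-(G s).real univ) * (Measure.pi fun _ => G s).real (kernelClass Ω d) ∂P =
      Real.exp (G₀.real univ * laplaceExponent ν (-1)) *
        ∏ j, G₀.real univ * tiltedMoment ν {i | d i = j}.ncard := by
  classical
  have := measurableEq_of_countablySeparated (Ω := Ω)
  obtain ⟨g, hg⟩ := exists_isSeparatingSequence (Ω := Ω)
  have hcard (j : J) : {i | d i = j}.ncard ≠ 0 := by
    obtain ⟨i, hi⟩ := hd j
    exact ncard_ne_zero_of_mem hi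
  have hleft : Tendsto (fun N => ∫ s, Real.exp (-(G s).real univ) *
      (Measure.pi fun _ => G s).real {y | g N ∘ y ∈ kernelClass (Fin N → Bool) d} ∂P) atTop
      (𝓝 (∫ s, Real.exp (-(G s).real univ) *
        (Measure.pi fun _ => G s).real (kernelClass Ω d) ∂P)) := by
    refine tendsto_integral_of_dominated_convergence (fun _ => (Fintype.card ι).factorial)
      (fun N => (hG.integrable_exp_neg_mul_measureReal_pi (hg.measurable N) _).1)
      (integrable_const _) (fun N => ?_) ?_
    · filter_upwards [hG.ae_isFiniteMeasure] with s hs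
      rw [Real.norm_of_nonneg (by positivity)]
      exact exp_neg_mul_measureReal_pi_le_factorial (G s) _
    · filter_upwards [hG.ae_isFiniteMeasure] with s hs
      exact (hg.tendsto_measureReal_kernelClass d _).const_mul _
  -- A Bell polynomial has no constant term, and only its linear term survives the refinement.
  have hright := hg.tendsto_sum_injective_prod G₀ (q := fun j x =>
    (bellPolynomial (tiltedMoment ν) {i | d i = j}.ncard).divX.eval x) fun j =>
      Polynomial.continuous _
  simp only [mul_eval_divX_bellPolynomial _ (hcard _), eval_zero_divX_bellPolynomial _ (hcard _)]
    at hright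
  refine tendsto_nhds_unique hleft ((hright.const_mul _).congr fun N => ?_)
  exact (hG.integral_exp_neg_mul_measureReal_pi_postcomp_kernelClass hν (hg.measurable N) hd).symm


end IsCompletelyRandomMeasure

end CompletelyRandomMeasure

section Countable

variable {α : Type*} [MeasurableSpace α] [Countable α] [MeasurableSingletonClass α]

theorem hasSum_measureReal_singleton (μ : Measure α) [IsFiniteMeasure μ] (A : Set α) :
    HasSum (fun a : A => μ.real {(a : α)}) (μ.real A) := by
  have hsum := tsum_measure_preimage_singleton (μ := μ) (f := id) A.to_countable
    fun a _ => measurableSet_singleton a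
  have hne (a : A) : μ {(a : α)} ≠ ⊤ := measure_ne_top μ _
  simp only [preimage_id] at hsum
  simp only [measureReal_def]
  rw [← hsum, ENNReal.tsum_toReal_eq hne]
  exact (ENNReal.summable_toReal (hsum ▸ measure_ne_top μ A)).hasSum

end Countable

theorem measurableSet_kernelClass {Ω ι β : Type*} [MeasurableSpace Ω] [MeasurableEq Ω]
    [Countable ι] (d : ι → β) : MeasurableSet (kernelClass Ω d) := by
  have hset : kernelClass Ω d = ⋂ i, ⋂ j, {x | x i = x j ↔ d i = d j} := by
    ext x
    simp [mem_kernelClass]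
  rw [hset]
  refine .iInter fun i => .iInter fun j => ?_
  have hij : MeasurableSet {x : ι → Ω | x i = x j} :=
    measurableSet_eq_fun (measurable_pi_apply i) (measurable_pi_apply j)
  by_cases h : d i = d j
  · simpa only [h, iff_true] using hij
  · simpa only [h, iff_false] using! hij.compl

section Labels

/-- The measure `∑_{k < K} r_k δ_k` on the labels of the atoms, whose normalization is the
conditional law of a label. -/
def labelMeasure (K : ℕ∞) (r : ℕ → ℝ) : Measure ℕ :=
  atomicMeasure K r id

variable {Ω : Type*} [MeasurableSpace Ω] {K : ℕ∞} {r : ℕ → ℝ} {ω : ℕ → Ω}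

theorem map_labelMeasure (K : ℕ∞) (r : ℕ → ℝ) (ω : ℕ → Ω) :
    (labelMeasure K r).map ω = atomicMeasure K r ω := by
  rw [labelMeasure, atomicMeasure, Measure.map_sum .of_discrete]
  simp only [Measure.map_smul, Measure.map_dirac' (.of_discrete (f := ω)), id, atomicMeasure]

theorem labelMeasure_univ (K : ℕ∞) (r : ℕ → ℝ) (ω : ℕ → Ω) :
    labelMeasure K r univ = atomicMeasure K r ω univ := by
  rw [← map_labelMeasure, Measure.map_apply .of_discrete .univ, preimage_univ]

theorem labelMeasure_real_univ (K : ℕ∞) (r : ℕ → ℝ) (ω : ℕ → Ω) :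
    (labelMeasure K r).real univ = (atomicMeasure K r ω).real univ :=
  congrArg ENNReal.toReal (labelMeasure_univ K r ω)

theorem isFiniteMeasure_labelMeasure (K : ℕ∞) (r : ℕ → ℝ) (ω : ℕ → Ω)
    [IsFiniteMeasure (atomicMeasure K r ω)] : IsFiniteMeasure (labelMeasure K r) :=
  ⟨labelMeasure_univ K r ω ▸ measure_lt_top _ _⟩

theorem labelMeasure_singleton (K : ℕ∞) (r : ℕ → ℝ) (k : ℕ) :
    labelMeasure K r {k} = if (k : ℕ∞) < K then ENNReal.ofReal (r k) else 0 := by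
  rw [labelMeasure, atomicMeasure, Measure.sum_apply _ (measurableSet_singleton k)]
  split_ifs with hk
  · rw [tsum_eq_single (⟨k, hk⟩ : {k : ℕ // (k : ℕ∞) < K}) fun j hj => ?_]
    · simp
    · simp [Subtype.ext_iff.not.1 hj]
  · refine ENNReal.tsum_eq_zero.2 fun j => ?_
    have hjk : (j : ℕ) ≠ k := fun h => hk (h ▸ j.2)
    simp [hjk]

theorem ae_labelMeasure_lt (K : ℕ∞) (r : ℕ → ℝ) : ∀ᵐ k : ℕ ∂labelMeasure K r, (k : ℕ∞) < K := by
  refine ae_iff_of_countable.2 fun k hk => by_contra fun hlt => hk ?_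
  rw [labelMeasure_singleton, if_neg hlt]

theorem labelMeasure_real_singleton (hr : ∀ k : ℕ, (k : ℕ∞) < K → 0 < r k) (k : ℕ) :
    (labelMeasure K r).real {k} = if (k : ℕ∞) < K then r k else 0 := by
  rw [measureReal_def, labelMeasure_singleton]
  split_ifs with hk
  · exact ENNReal.toReal_ofReal (hr k hk).le
  · rfl

theorem likelihood_eq_exp_neg_mul_measureReal_pi (hr : ∀ k : ℕ, (k : ℕ∞) < K → 0 < r k)
    [IsFiniteMeasure (atomicMeasure K r ω)] {m : ℕ} (c : Fin m → ℕ) :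
    likelihood K r ω m c = Real.exp (-(atomicMeasure K r ω).real univ) / m.factorial *
      (Measure.pi fun _ => labelMeasure K r).real {c} := by
  have := isFiniteMeasure_labelMeasure K r ω
  have hle (i : Fin m) : (labelMeasure K r).real {c i} ≤ (atomicMeasure K r ω).real univ := by
    rw [← labelMeasure_real_univ]
    exact measureReal_mono (subset_univ _)
  have hfactor (i : Fin m) : (atomicMeasure K r ω).real univ *
      (if (c i : ℕ∞) < K then r (c i) / (atomicMeasure K r ω).real univ else 0) =
        (labelMeasure K r).real {c i} := by
    rw [labelMeasure_real_singleton hr, mul_ite, mul_zero]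
    split_ifs with hk
    · refine mul_div_cancel_of_imp' fun hzero => ?_
      have := hle i
      rw [labelMeasure_real_singleton hr, if_pos hk] at this
      exact le_antisymm (this.trans hzero.le) (hr _ hk).le
    · rfl
  rw [likelihood, poissonMeasure_real_singleton, measureReal_pi_singleton]
  simp only [← hfactor, Finset.prod_mul_distrib, Finset.prod_const, Finset.card_univ,
    Fintype.card_fin, ← measureReal_def, ENNReal.coe_toNNReal_eq_toReal]
  ring

theorem measureReal_pi_atomicMeasure_kernelClass [MeasurableEq Ω]
    [IsFiniteMeasure (atomicMeasure K r ω)] {ι β : Type*} [Fintype ι] (d : ι → β)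
    (hω : ∀ j k : ℕ, (j : ℕ∞) < K → (k : ℕ∞) < K → ω j = ω k → j = k) :
    (Measure.pi fun _ => atomicMeasure K r ω).real (kernelClass Ω d) =
      (Measure.pi fun _ => labelMeasure K r).real (kernelClass ℕ d) := by
  have := isFiniteMeasure_labelMeasure K r ω
  have hlt : ∀ᵐ x ∂Measure.pi fun _ : ι => labelMeasure K r, ∀ i, (x i : ℕ∞) < K :=
    ae_all_iff.2 fun i =>
      (Measure.tendsto_eval_ae_ae (μ := fun _ : ι => labelMeasure K r)).eventually
        (ae_labelMeasure_lt K r)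
  have hmeas : Measurable fun x : ι → ℕ => ω ∘ x := measurable_postcomp .of_discrete
  simp only [← map_labelMeasure K r ω]
  rw [← map_postcomp_pi (labelMeasure K r) .of_discrete,
    map_measureReal_apply hmeas (measurableSet_kernelClass d)]
  refine measureReal_congr (hlt.mono fun x hx => propext ?_)
  refine comp_mem_kernelClass_iff ?_
  rintro _ ⟨i, rfl⟩ _ ⟨j, rfl⟩ h
  exact hω _ _ (hx i) (hx j) h

end Labels

section Relabel

variable {m : ℕ}

theorem exists_first_occurrence (z : Fin m → ℕ) (i : Fin m) :
    ∃ j, z j = z i ∧ ∀ k, z k = z i → j ≤ k := by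
  obtain ⟨j, hj, hmin⟩ := (Finset.univ.filter fun j => z j = z i).exists_min_image id ⟨i, by simp⟩
  exact ⟨j, by simpa using hj, fun k hk => hmin k (by simpa using hk)⟩

theorem eq_of_relabel_eq {z : Fin m → ℕ} {i j : Fin m}
    (h : relabel z i = relabel z j) : z i = z j := by
  obtain ⟨p, hp, hpmin⟩ := exists_first_occurrence z i
  obtain ⟨q, hq, hqmin⟩ := exists_first_occurrence z j
  wlog hpq : p ≤ q generalizing i j p q
  · exact (this h.symm q hq hqmin p hp hpmin (le_of_not_ge hpq)).symm
  by_contra hne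
  refine h.not_lt (Finset.card_lt_card ((Finset.ssubset_iff_of_subset ?_).2
    ⟨z j, Finset.mem_image.2 ⟨q, by simpa using hqmin, hq⟩, fun hmem => ?_⟩))
  · refine Finset.image_subset_image fun k hk => ?_
    simp only [Finset.mem_filter, Finset.mem_univ, true_and] at hk ⊢
    exact fun n hn => ((hk p hp).trans hpq).trans (hqmin n hn)
  · obtain ⟨k, hk, hkj⟩ := Finset.mem_image.1 hmem
    have hkp : k ≤ p := (Finset.mem_filter.1 hk).2 p hp
    obtain rfl : q = p := le_antisymm ((hqmin k hkj).trans hkp) hpq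
    exact hne (hp.symm.trans hq)

theorem mem_kernelClass_relabel (z : Fin m → ℕ) : z ∈ kernelClass ℕ (relabel z) :=
  fun i j => ⟨fun h => by simp only [relabel, h], eq_of_relabel_eq⟩

theorem relabel_eq_of_mem_kernelClass {z c : Fin m → ℕ} (h : z ∈ kernelClass ℕ c) :
    relabel z = relabel c := by
  obtain ⟨g, rfl⟩ : ∃ g : ℕ → ℕ, z = g ∘ c :=
    ⟨Function.extend c z 0, (Function.FactorsThrough.extend_comp (f := c) (g := z) 0
      fun i j hij => (h i j).2 hij).symm⟩
  funext i
  simp only [relabel, h _ _]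
  rw [← Finset.image_image, Finset.card_image_of_injOn]
  intro a ha b hb hab
  obtain ⟨j, -, rfl⟩ := Finset.mem_image.1 (Finset.mem_coe.1 ha)
  obtain ⟨k, -, rfl⟩ := Finset.mem_image.1 (Finset.mem_coe.1 hb)
  exact (h j k).1 hab

theorem relabel_eq_iff_mem_kernelClass {z c : Fin m → ℕ} (hc : relabel c = c) :
    relabel z = c ↔ z ∈ kernelClass ℕ c :=
  ⟨fun h => h ▸ mem_kernelClass_relabel z, fun h => (relabel_eq_of_mem_kernelClass h).trans hc⟩

theorem image_eq_Icc_numClusters {c : Fin m → ℕ} (hc : relabel c = c) :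
    Finset.univ.image c = Finset.Icc 1 (numClusters c) := by
  refine Finset.eq_of_subset_of_card_le (fun a ha => ?_) (by simp [numClusters])
  obtain ⟨i, -, rfl⟩ := Finset.mem_image.1 ha
  rw [← congrFun hc i, Finset.mem_Icc]
  constructor
  · obtain ⟨j, -, hjmin⟩ := exists_first_occurrence c i
    exact Finset.card_pos.2 ⟨c j, Finset.mem_image.2 ⟨j, by simpa using hjmin, rfl⟩⟩
  · exact Finset.card_le_card (Finset.image_subset_image (Finset.subset_univ _))

end Relabel

theorem analyticAt_and_coeff_eq_iteratedDeriv_of_hasSum {F : ℝ → ℝ} {p : ℕ → ℝ}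
    (h : ∀ t : ℝ, |t| ≤ 1 → HasSum (fun n => p n * t ^ n) (F t)) :
    AnalyticAt ℝ F 0 ∧ ∀ n, p n = iteratedDeriv n F 0 / n.factorial := by
  have hradius : 1 ≤ (FormalMultilinearSeries.ofScalars ℝ p).radius := by
    refine FormalMultilinearSeries.le_radius_of_summable (r := 1) _ ?_
    simpa [FormalMultilinearSeries.ofScalars_norm] using (h 1 (by simp)).summable.abs
  have hball : HasFPowerSeriesOnBall F (FormalMultilinearSeries.ofScalars ℝ p) 0 1 := by
    refine ⟨hradius, one_pos, fun {y} hy => ?_⟩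
    have hy' : |y| ≤ 1 := by
      rw [mem_eball_zero_iff, ← ofReal_norm, ENNReal.ofReal_lt_one] at hy
      exact hy.le
    simpa [FormalMultilinearSeries.ofScalars_apply_eq, mul_comm] using h y hy'
  have heq := hball.hasFPowerSeriesAt.eq_formalMultilinearSeries
    hball.analyticAt.hasFPowerSeriesAt
  exact ⟨hball.analyticAt, congrFun (FormalMultilinearSeries.ofScalars_series_injective ℝ ℝ heq)⟩

theorem hasSum_integral_exp_neg_mul_pow {S : Type*} [MeasurableSpace S] {P : Measure S}
    [IsFiniteMeasure P] {g : S → ℝ} (hg : Measurable g) (hg0 : ∀ s, 0 ≤ g s) {t : ℝ}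
    (ht : |t| ≤ 1) :
    HasSum (fun m : ℕ => (∫ s, Real.exp (-g s) * g s ^ m ∂P) / m.factorial * t ^ m)
      (∫ s, Real.exp (-(1 - t) * g s) ∂P) := by
  have hexp (x : ℝ) : HasSum (fun m : ℕ => x ^ m / m.factorial) (Real.exp x) := by
    rw [Real.exp_eq_exp_ℝ]
    exact NormedSpace.expSeries_div_hasSum_exp x
  have hterm (t : ℝ) (s : S) :
      HasSum (fun m : ℕ => Real.exp (-g s) * ((t * g s) ^ m / m.factorial))
        (Real.exp (-(1 - t) * g s)) := by
    convert! (hexp (t * g s)).mul_left (Real.exp (-g s)) using 1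
    rw [← Real.exp_add]
    ring_nf
  have hbound : Integrable
      (fun s => ∑' m : ℕ, Real.exp (-g s) * ((|t| * g s) ^ m / m.factorial)) P := by
    simp only [(hterm |t| _).tsum_eq]
    refine (integrable_const (1 : ℝ)).mono' (by fun_prop) (.of_forall fun s => ?_)
    rw [Real.norm_of_nonneg (Real.exp_nonneg _), Real.exp_le_one_iff, neg_mul,
      Left.neg_nonpos_iff]
    exact mul_nonneg (sub_nonneg.2 ht) (hg0 s)
  have hle (m : ℕ) (s : S) : ‖Real.exp (-g s) * ((t * g s) ^ m / m.factorial)‖ ≤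
      Real.exp (-g s) * ((|t| * g s) ^ m / m.factorial) := by
    rw [norm_mul, norm_div, norm_pow, norm_mul, Real.norm_of_nonneg (Real.exp_nonneg _),
      Real.norm_of_nonneg (hg0 s), Real.norm_eq_abs t, Real.norm_natCast]
  have hmeas (m : ℕ) : AEStronglyMeasurable
      (fun s => Real.exp (-g s) * ((t * g s) ^ m / m.factorial)) P :=
    Measurable.aestronglyMeasurable (by fun_prop)
  refine (hasSum_integral_of_dominated_convergence _ hmeas (fun m => .of_forall (hle m))
    (.of_forall fun s => (hterm |t| s).summable) hbound (.of_forall (hterm t))).congr_fun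
      fun m => ?_
  rw [← integral_div, ← integral_mul_const]
  congr with s
  ring

section Size

variable {S : Type*} [MeasurableSpace S] {P : Measure S} [IsFiniteMeasure P] {M : S → ℕ}

theorem integrable_pow_size (hM : Measurable M) {t : ℝ} (ht : |t| ≤ 1) :
    Integrable (fun s => t ^ M s) P := by
  refine (integrable_const (1 : ℝ)).mono' ?_ (Eventually.of_forall fun s => ?_)
  · exact ((measurable_of_countable fun n : ℕ => t ^ n).comp hM).aestronglyMeasurable
  · rw [norm_pow, Real.norm_eq_abs]
    exact pow_le_one₀ (abs_nonneg t) ht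

theorem hasSum_sizePGF (hM : Measurable M) {t : ℝ} (ht : |t| ≤ 1) :
    HasSum (fun n => sizePMF P M n * t ^ n) (sizePGF P M t) := by
  have hlevel (n : ℕ) : MeasurableSet (M ⁻¹' {n}) := hM (measurableSet_singleton n)
  have hcover : ⋃ n, M ⁻¹' {n} = univ := eq_univ_of_forall fun s => mem_iUnion.2 ⟨M s, rfl⟩
  have hsum := hasSum_integral_iUnion hlevel
    (fun m n hmn => (disjoint_singleton.2 hmn).preimage M)
    (integrable_pow_size (P := P) hM ht).integrableOn
  rw [hcover, setIntegral_univ] at hsum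
  refine hsum.congr_fun fun n => ?_
  rw [setIntegral_congr_fun (hlevel n) (g := fun _ => t ^ n) fun s hs => congrArg (t ^ ·) hs,
    setIntegral_const]
  rfl

end Size

section LabelLaw

variable {S : Type*} [MeasurableSpace S]

/-- The law of the first `m` labels on the event that the sample has size `m`; its total mass is
the probability of that event. -/
def labelLaw (P : Measure S) (M : S → ℕ) (z : ℕ → S → ℕ) (m : ℕ) : Measure (Fin m → ℕ) :=
  (P.restrict {s | M s = m}).map fun s i => z i s

variable {P : Measure S} {M : S → ℕ} {z : ℕ → S → ℕ}

instance [IsFiniteMeasure P] (m : ℕ) : IsFiniteMeasure (labelLaw P M z m) :=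
  inferInstanceAs (IsFiniteMeasure (Measure.map _ _))

theorem labelLaw_real_apply (hz : ∀ i, Measurable (z i)) (m : ℕ)
    (A : Set (Fin m → ℕ)) :
    (labelLaw P M z m).real A = P.real {s | M s = m ∧ (fun i : Fin m => z i s) ∈ A} := by
  have hzm : Measurable fun s => fun i : Fin m => z i s := measurable_pi_lambda _ fun i => hz i
  rw [labelLaw, map_measureReal_apply hzm .of_discrete,
    measureReal_restrict_apply (hzm .of_discrete), inter_comm]
  rfl

theorem eppf_eq_ecpf_div_sizePMF (hM : Measurable M) (m : ℕ) (c : Fin m → ℕ) :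
    eppf P M z m c = ecpf P M z m c / sizePMF P M m := by
  rw [eppf, measureReal_def, cond_apply (s := {s | M s = m}) (hM (measurableSet_singleton m)),
    ENNReal.toReal_mul, ENNReal.toReal_inv, mul_comm, ← div_eq_mul_inv]
  rfl

theorem isExchangeable_eppf (hM : Measurable M) (h : IsExchangeable (ecpf P M z)) :
    IsExchangeable (eppf P M z) := fun m c c' hc hc' hcc => by
  rw [eppf_eq_ecpf_div_sizePMF hM, eppf_eq_ecpf_div_sizePMF hM, h m c c' hc hc' hcc]

end LabelLaw

theorem ecpfFormula_congr {γ₀ : ℝ} {ρ : Measure ℝ} {m : ℕ} {c c' : Fin m → ℕ}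
    (h : clusterSizes c = clusterSizes c') : ecpfFormula γ₀ ρ m c = ecpfFormula γ₀ ρ m c' := by
  have hnum (c : Fin m → ℕ) : numClusters c = (clusterSizes c).card := by simp [clusterSizes]
  have hprod (c : Fin m → ℕ) : ∏ k ∈ Finset.Icc 1 (numClusters c),
      tiltedMoment (ρ.restrict (Ioi 0)) (clusterSize c k) =
        ((clusterSizes c).map (tiltedMoment (ρ.restrict (Ioi 0)))).prod := by
    rw [clusterSizes, Multiset.map_map]
    rfl
  have hformula (c : Fin m → ℕ) : ecpfFormula γ₀ ρ m c =
      γ₀ ^ (clusterSizes c).card / m.factorial *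
        Real.exp (γ₀ * ∫ r in Ioi (0 : ℝ), (Real.exp (-r) - 1) ∂ρ) *
          ((clusterSizes c).map (tiltedMoment (ρ.restrict (Ioi 0)))).prod := by
    rw [← hprod, ← hnum]
    rfl
  rw [hformula, hformula, h]

/-- The random measure `G = ∑_{k < K} r_k δ_{ω_k}` of the count-mixture model. -/
abbrev randomMeasure {S Ω : Type*} [MeasurableSpace Ω] (K : S → ℕ∞) (r : ℕ → S → ℝ)
    (ω : ℕ → S → Ω) (s : S) : Measure Ω :=
  atomicMeasure (K s) (fun k => r k s) fun k => ω k s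

namespace IsCountMixture

variable {S Ω : Type*} [MeasurableSpace S] [MeasurableSpace Ω] {P : Measure S}
  {G₀ : Measure Ω} {ρ : Measure ℝ}
  {K : S → ℕ∞} {r : ℕ → S → ℝ} {ω : ℕ → S → Ω} {M : S → ℕ} {z : ℕ → S → ℕ}

theorem atomsSigma_le (h : IsCountMixture P G₀ ρ K r ω M z) :
    atomsSigma K r ω ≤ ‹MeasurableSpace S› :=
  (h.measurable_K.prodMk ((measurable_pi_lambda _ h.measurable_r).prodMk
    (measurable_pi_lambda _ h.measurable_ω))).comap_le

theorem measurableSet_sample (h : IsCountMixture P G₀ ρ K r ω M z) (m : ℕ)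
    (A : Set (Fin m → ℕ)) : MeasurableSet {s | M s = m ∧ (fun i : Fin m => z i s) ∈ A} :=
  (h.measurable_M (measurableSet_singleton m)).inter
    (measurable_pi_lambda _ (fun i : Fin m => h.measurable_z i) (.of_discrete (s := A)))

theorem integrable_likelihood [IsFiniteMeasure P] (h : IsCountMixture P G₀ ρ K r ω M z) {m : ℕ}
    (c : Fin m → ℕ) :
    Integrable (fun s => likelihood (K s) (fun k => r k s) (fun k => ω k s) m c) P :=
  integrable_condExp.congr (h.sample m c)

theorem labelLaw_real_singleton [IsFiniteMeasure P] (h : IsCountMixture P G₀ ρ K r ω M z)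
    {m : ℕ} (c : Fin m → ℕ) : (labelLaw P M z m).real {c} =
      ∫ s, likelihood (K s) (fun k => r k s) (fun k => ω k s) m c ∂P := by
  rw [labelLaw_real_apply h.measurable_z, ← integral_congr_ae (h.sample m c),
    integral_condExp h.atomsSigma_le]
  exact (integral_indicator_one (h.measurableSet_sample m {c})).symm

theorem labelLaw_real_eq_integral [IsFiniteMeasure P] (h : IsCountMixture P G₀ ρ K r ω M z)
    {m : ℕ} (A : Set (Fin m → ℕ)) : (labelLaw P M z m).real A =
      (∫ s, Real.exp (-(randomMeasure K r ω s).real univ) *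
        (Measure.pi fun _ => labelMeasure (K s) fun k => r k s).real A ∂P) / m.factorial := by
  have hnorm (c : Fin m → ℕ) :
      ∫ s, ‖likelihood (K s) (fun k => r k s) (fun k => ω k s) m c‖ ∂P =
        (labelLaw P M z m).real {c} := by
    rw [h.labelLaw_real_singleton]
    refine integral_congr_ae ?_
    filter_upwards [h.pos, h.crm.ae_isFiniteMeasure] with s hpos hfin
    rw [likelihood_eq_exp_neg_mul_measureReal_pi hpos]
    exact Real.norm_of_nonneg (by positivity)
  have hlaw := hasSum_measureReal_singleton (labelLaw P M z m) A
  have hsum := hasSum_integral_of_summable_integral_norm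
    (F := fun (c : A) s => likelihood (K s) (fun k => r k s) (fun k => ω k s) m c)
    (fun c => h.integrable_likelihood c.1) (by simpa only [hnorm] using hlaw.summable)
  simp only [← h.labelLaw_real_singleton] at hsum
  rw [hlaw.unique hsum, ← integral_div]
  refine integral_congr_ae ?_
  filter_upwards [h.pos, h.crm.ae_isFiniteMeasure] with s hpos hfin
  have := isFiniteMeasure_labelMeasure (K s) (fun k => r k s) fun k => ω k s
  simp only [likelihood_eq_exp_neg_mul_measureReal_pi hpos]
  rw [((hasSum_measureReal_singleton _ A).mul_left _).tsum_eq, div_mul_eq_mul_div]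

theorem sizePMF_eq_integral [IsFiniteMeasure P] (h : IsCountMixture P G₀ ρ K r ω M z) (m : ℕ) :
    sizePMF P M m =
      (∫ s, Real.exp (-(randomMeasure K r ω s).real univ) *
        (randomMeasure K r ω s).real univ ^ m ∂P) /
          m.factorial := by
  have hlaw : sizePMF P M m = (labelLaw P M z m).real univ := by
    simp only [labelLaw_real_apply h.measurable_z, mem_univ, and_true, sizePMF]
  rw [hlaw, h.labelLaw_real_eq_integral]
  congr 1
  refine integral_congr_ae ?_
  filter_upwards [h.crm.ae_isFiniteMeasure] with s hfin
  have := isFiniteMeasure_labelMeasure (K s) (fun k => r k s) fun k => ω k s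
  rw [measureReal_pi_univ, Fintype.card_fin, labelMeasure_real_univ _ _ fun k => ω k s]

theorem sizePGF_eq [IsProbabilityMeasure P] [IsFiniteMeasure G₀]
    (h : IsCountMixture P G₀ ρ K r ω M z)
    (hρ : ∫⁻ r in Ioi (0 : ℝ), ENNReal.ofReal (min 1 r) ∂ρ < ⊤) {t : ℝ} (ht : |t| ≤ 1) :
    sizePGF P M t =
      Real.exp (G₀.real univ * laplaceExponent (ρ.restrict (Ioi 0)) (-(1 - t))) := by
  have := sFinite_restrict_Ioi hρ
  have hsum := hasSum_sizePGF (P := P) h.measurable_M ht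
  simp only [h.sizePMF_eq_integral] at hsum
  rw [hsum.unique (hasSum_integral_exp_neg_mul_pow (h.crm.measurable_measureReal .univ)
    (fun s => measureReal_nonneg) ht)]
  exact IsCompletelyRandomMeasure.integral_exp_mul_measureReal h.crm
    (isSubordinatorMeasure_restrict_Ioi hρ) .univ (neg_nonpos.2 (sub_nonneg.2 (le_of_abs_le ht)))

theorem ecpf_eq_integral_condExp [IsFiniteMeasure P] (h : IsCountMixture P G₀ ρ K r ω M z) (m : ℕ)
    (c : Fin m → ℕ) :
    ecpf P M z m c = ∫ s, (P⟦clusterEvent M z m c | atomsSigma K r ω⟧) s ∂P := by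
  rw [integral_condExp h.atomsSigma_le]
  exact (integral_indicator_one (h.measurableSet_sample m {x | relabel x = c})).symm

theorem ecpf_eq_integral_kernelClass [IsFiniteMeasure P] [MeasurableEq Ω]
    (h : IsCountMixture P G₀ ρ K r ω M z) {m : ℕ} {c : Fin m → ℕ} (hc : relabel c = c) :
    ecpf P M z m c =
      (∫ s, Real.exp (-(randomMeasure K r ω s).real univ) *
        (Measure.pi fun _ => randomMeasure K r ω s).real
          (kernelClass Ω c) ∂P) / m.factorial := by
  have hlaw : ecpf P M z m c = (labelLaw P M z m).real (kernelClass ℕ c) := by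
    simp only [labelLaw_real_apply h.measurable_z, ecpf, clusterEvent,
      relabel_eq_iff_mem_kernelClass hc]
  rw [hlaw, h.labelLaw_real_eq_integral]
  congr 1
  refine integral_congr_ae ?_
  filter_upwards [h.distinct, h.crm.ae_isFiniteMeasure] with s hdistinct hfin
  rw [measureReal_pi_atomicMeasure_kernelClass c hdistinct]

theorem ecpf_eq_ecpfFormula [IsProbabilityMeasure P] [IsFiniteMeasure G₀]
    [MeasurableSpace.CountablySeparated Ω] [NullSingletonClass G₀]
    (h : IsCountMixture P G₀ ρ K r ω M z)
    (hρ : ∫⁻ r in Ioi (0 : ℝ), ENNReal.ofReal (min 1 r) ∂ρ < ⊤) {m : ℕ} {c : Fin m → ℕ}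
    (hc : relabel c = c) : ecpf P M z m c = ecpfFormula (G₀.real univ) ρ m c := by
  have := measurableEq_of_countablySeparated (Ω := Ω)
  have := sFinite_restrict_Ioi hρ
  let d : Fin m → Finset.univ.image c := fun i => ⟨c i, Finset.mem_image_of_mem c (by simp)⟩
  have hd : Function.Surjective d := by
    rintro ⟨_, hk⟩
    obtain ⟨i, -, rfl⟩ := Finset.mem_image.1 hk
    exact ⟨i, rfl⟩
  have hclass : kernelClass Ω c = kernelClass Ω d :=
    kernelClass_comp Subtype.val_injective d
  have hsize (k : Finset.univ.image c) : {i | d i = k}.ncard = clusterSize c k := by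
    rw [clusterSize, ← ncard_coe_finset]
    simp [d, Subtype.ext_iff]
  have hlaplace : laplaceExponent (ρ.restrict (Ioi 0)) (-1) =
      ∫ r in Ioi (0 : ℝ), (Real.exp (-r) - 1) ∂ρ := by
    simp only [laplaceExponent, neg_one_mul]
  rw [h.ecpf_eq_integral_kernelClass hc, hclass,
    IsCompletelyRandomMeasure.integral_exp_neg_mul_measureReal_pi_kernelClass h.crm
      (isSubordinatorMeasure_restrict_Ioi hρ) hd]
  simp only [hsize]
  rw [Finset.prod_coe_sort (Finset.univ.image c)
      fun k => G₀.real univ * tiltedMoment (ρ.restrict (Ioi 0)) (clusterSize c k),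
    image_eq_Icc_numClusters hc, Finset.prod_mul_distrib, Finset.prod_const, Nat.card_Icc,
    Nat.add_sub_cancel, hlaplace, ecpfFormula]
  simp only [tiltedMoment]
  ring

theorem isExchangeable_ecpf [IsProbabilityMeasure P] [IsFiniteMeasure G₀]
    [MeasurableSpace.CountablySeparated Ω] [NullSingletonClass G₀]
    (h : IsCountMixture P G₀ ρ K r ω M z)
    (hρ : ∫⁻ r in Ioi (0 : ℝ), ENNReal.ofReal (min 1 r) ∂ρ < ⊤) :
    IsExchangeable (ecpf P M z) := fun m c c' hc hc' hcc => by
  rw [h.ecpf_eq_ecpfFormula hρ hc, h.ecpf_eq_ecpfFormula hρ hc', ecpfFormula_congr hcc]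

end IsCountMixture

end CountMixture

end

theorem mainTheorem3 {S Ω : Type*} [MeasurableSpace S] [MeasurableSpace Ω]
    [MeasurableSpace.CountablySeparated Ω]
    (P : Measure S) [IsProbabilityMeasure P]
    (G₀ : Measure Ω) [IsFiniteMeasure G₀] [NullSingletonClass G₀]
    (ρ : Measure ℝ) (hρ : ∫⁻ r in Ioi (0 : ℝ), ENNReal.ofReal (min 1 r) ∂ρ < ⊤)
    (K : S → ℕ∞) (r : ℕ → S → ℝ) (ω : ℕ → S → Ω) (M : S → ℕ) (z : ℕ → S → ℕ)
    (h : CountMixture.IsCountMixture P G₀ ρ K r ω M z) :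
    -- the integrals in the formulas converge
    (∀ t : ℝ, |t| ≤ 1 → IntegrableOn (fun r => Real.exp (-(1 - t) * r) - 1) (Ioi 0) ρ) ∧
    (∀ n : ℕ, 1 ≤ n → IntegrableOn (fun r => r ^ n * Real.exp (-r)) (Ioi 0) ρ) ∧
    -- the ECPF
    (∀ (m : ℕ) (c : Fin m → ℕ), CountMixture.relabel c = c →
      CountMixture.ecpf P M z m c =
        ∫ s, (P⟦CountMixture.clusterEvent M z m c | CountMixture.atomsSigma K r ω⟧) s ∂P ∧
      CountMixture.ecpf P M z m c = CountMixture.ecpfFormula (G₀.real univ) ρ m c) ∧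
    CountMixture.IsExchangeable (CountMixture.ecpf P M z) ∧
    -- the sample size: PGF and PMF
    (∀ t : ℝ, |t| ≤ 1 → Integrable (fun s => t ^ M s) P ∧
      CountMixture.sizePGF P M t =
        Real.exp (G₀.real univ *
          ∫ r in Ioi (0 : ℝ), (Real.exp (-(1 - t) * r) - 1) ∂ρ)) ∧
    AnalyticAt ℝ (CountMixture.sizePGF P M) 0 ∧
    (∀ m : ℕ, CountMixture.sizePMF P M m =
      iteratedDeriv m (CountMixture.sizePGF P M) 0 / (m.factorial : ℝ)) ∧
    -- the EPPF
    (∀ (m : ℕ) (c : Fin m → ℕ), CountMixture.relabel c = c → 0 < CountMixture.sizePMF P M m →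
      CountMixture.eppf P M z m c =
        CountMixture.ecpf P M z m c / CountMixture.sizePMF P M m ∧
      CountMixture.eppf P M z m c =
        CountMixture.ecpfFormula (G₀.real univ) ρ m c / CountMixture.sizePMF P M m) ∧
    CountMixture.IsExchangeable (CountMixture.eppf P M z) := by
  have hν := CountMixture.isSubordinatorMeasure_restrict_Ioi hρ
  have hecpf := h.isExchangeable_ecpf hρ
  have hpgf := CountMixture.analyticAt_and_coeff_eq_iteratedDeriv_of_hasSum
    fun t ht => CountMixture.hasSum_sizePGF (P := P) h.measurable_M ht
  refine ⟨fun t ht => hν.integrable_exp_mul_sub_one (by linarith [le_of_abs_le ht]),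
    fun n hn => hν.integrable_pow_mul_exp_neg (Nat.one_le_iff_ne_zero.1 hn),
    fun m c hc => ⟨h.ecpf_eq_integral_condExp m c, h.ecpf_eq_ecpfFormula hρ hc⟩, hecpf,
    fun t ht => ⟨CountMixture.integrable_pow_size h.measurable_M ht, h.sizePGF_eq hρ ht⟩,
    hpgf.1, hpgf.2, fun m c hc _ => ?_, CountMixture.isExchangeable_eppf h.measurable_M hecpf⟩
  have heppf := CountMixture.eppf_eq_ecpf_div_sizePMF (P := P) (z := z) h.measurable_M m c
  exact ⟨heppf, h.ecpf_eq_ecpfFormula hρ hc ▸ heppf⟩
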